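/- Let $(\Omega,\mathcal F,(\mathcal F_t)_{t\ge 0},\mathbb P)$ be a filtered probability space satisfying the usual conditions (right-continuity and completeness). Let $X=(X_t)_{t\ge0}$ be a spectrally negative Lévy process relative to $(\mathcal F_t)$ (a càdlàg Lévy process with no positive jumps and with paths that are not almost surely monotone), and let $N=(N_t)_{t\ge0}$ be a Poisson process relative to $(\mathcal F_t)$ of intensity $\lambda>0$, with $X$ and $N$ independent. Let $p\in(0,1)$, and consider the stochastic differential equation $$\mathrm dU_t=\mathrm dX_t-(1-p)\,U_{t-}\,\mathrm dN_t ,\qquad U_0=\xi ,$$ where $\xi$ is an $\mathcal F_0$-measurable real random variable (for instance a constant $x_0\in\mathbb R$). A solution is an $(\mathcal F_t)$-adapted process $U$ with almost surely càdlàg paths such that, almost surely, for all $t\ge0$, $$U_t=\xi+X_t-X_0-(1-p)\int_{(0,t]}U_{s-}\,\mathrm dN_s ,$$ and it is a strong solution if moreover each $U_t$ is measurable with respect to the $\sigma$-algebra generated by $\xi$, $(X_s,N_s)_{s\le t}$ and the $\mathbb P$-null sets. Then there is a Markov transition semigroup $(\kappa_t)_{t\ge0}$ of probability kernels on $\mathbb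 R$ such that, for every such $\xi$: 1. the equation has a strong solution; 2. any two solutions $U$ and $V$ are indistinguishable: $\mathbb P(U_t=V_t\text{ for all }t\ge0)=1$; 3. the solution $U$ is a strong Markov process with semigroup $(\kappa_t)$: for every $(\mathcal F_t)$-stopping time $\tau$ with values in $[0,\infty]$, every $t\ge0$ and every Borel set $B\subseteq\mathbb R$, $$\mathbb P(U_{\tau+t}\in B\mid\mathcal F_\tau)=\kappa_t(U_\tau,B)\quad\text{almost surely on }\{\tau<\infty\}.$$ -/

import Mathlib

open MeasureTheory ProbabilityTheory Filter Set
open scoped NNReal Topology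

namespace PartialResetting

/-- A path `f : [0, ∞) → ℝ` is càdlàg: right-continuous with finite left limits. -/
def IsCadlag (f : ℝ≥0 → ℝ) : Prop :=
  (∀ t, ContinuousWithinAt f (Ici t) t) ∧ ∀ t, ∃ l : ℝ, Tendsto f (𝓝[<] t) (𝓝 l)

variable {Ω : Type*} [mΩ : MeasurableSpace Ω]

/-- The usual conditions: the filtration is right-continuous and its initial σ-algebra contains
every `P`-null set (`P A` is the outer measure when `A` is not known to be measurable). -/
structure UsualConditions (𝓕 : Filtration ℝ≥0 mΩ) (P : Measure Ω) : Prop where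
  rightContinuous : 𝓕.IsRightContinuous
  complete : ∀ A : Set Ω, P A = 0 → MeasurableSet[𝓕 0] A

/-- `X` is a real Lévy process relative to the filtration `𝓕`. -/
structure IsLevyProcess (𝓕 : Filtration ℝ≥0 mΩ) (P : Measure Ω) (X : ℝ≥0 → Ω → ℝ) : Prop where
  adapted : Adapted 𝓕 X
  zero : ∀ᵐ ω ∂P, X 0 ω = 0
  cadlag : ∀ᵐ ω ∂P, IsCadlag (fun t => X t ω)
  indep : ∀ s t : ℝ≥0, s ≤ t →
    Indep (MeasurableSpace.comap (fun ω => X t ω - X s ω) inferInstance) (𝓕 s) P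
  stationary : ∀ s h : ℝ≥0,
    P.map (fun ω => X (s + h) ω - X s ω) = P.map (fun ω => X h ω - X 0 ω)

/-- `X` is a spectrally negative Lévy process relative to `𝓕`: a Lévy process without positive
jumps whose paths are not (almost surely) monotone. -/
structure IsSpectrallyNegativeLevy (𝓕 : Filtration ℝ≥0 mΩ) (P : Measure Ω)
    (X : ℝ≥0 → Ω → ℝ) : Prop extends IsLevyProcess 𝓕 P X where
  no_pos_jumps : ∀ᵐ ω ∂P, ∀ t, X t ω ≤ Function.leftLim (fun s => X s ω) t
  not_monotone : ¬ ∀ᵐ ω ∂P, Monotone (fun t => X t ω)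
  not_antitone : ¬ ∀ᵐ ω ∂P, Antitone (fun t => X t ω)

/-- `N` is a Poisson process of intensity `rate` relative to the filtration `𝓕`. (The subtraction
in `ℕ` is not truncated, as almost all paths are monotone.) -/
structure IsPoissonProcess (𝓕 : Filtration ℝ≥0 mΩ) (P : Measure Ω) (rate : ℝ≥0)
    (N : ℝ≥0 → Ω → ℕ) : Prop where
  adapted : Adapted 𝓕 N
  zero : ∀ᵐ ω ∂P, N 0 ω = 0
  monotone : ∀ᵐ ω ∂P, Monotone (fun t => N t ω)
  rightCts : ∀ᵐ ω ∂P, ∀ t, ContinuousWithinAt (fun s => N s ω) (Ici t) t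
  indep : ∀ s t : ℝ≥0, s ≤ t →
    Indep (MeasurableSpace.comap (fun ω => N t ω - N s ω) inferInstance) (𝓕 s) P
  law : ∀ s t : ℝ≥0, s ≤ t → P.map (fun ω => N t ω - N s ω) = poissonMeasure (rate * (t - s))

/-- `U` is a solution on the given filtered probability space of
`dU_t = dX_t - (1 - p) U_{t-} dN_t`, `U_0 = ξ`: it is adapted and càdlàg, and almost surely, for
all `t`, `U_t = ξ + (X_t - X_0) - (1 - p) ∫_{(0,t]} U_{s-} dN_s`. The integral is the pathwise
Lebesgue-Stieltjes integral against the nondecreasing right-continuous path `S = N(ω)`; as the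
path of `U` is càdlàg, the integrand is bounded and Borel on `(0,t]`, so the integral exists. -/
structure IsSolution (𝓕 : Filtration ℝ≥0 mΩ) (P : Measure Ω) (p : ℝ) (X : ℝ≥0 → Ω → ℝ)
    (N : ℝ≥0 → Ω → ℕ) (ξ : Ω → ℝ) (U : ℝ≥0 → Ω → ℝ) : Prop where
  adapted : Adapted 𝓕 U
  cadlag : ∀ᵐ ω ∂P, IsCadlag (fun t => U t ω)
  sde : ∀ᵐ ω ∂P, ∃ S : StieltjesFunction ℝ≥0, (∀ s, S s = (N s ω : ℝ)) ∧
    ∀ t, U t ω = ξ ω + (X t ω - X 0 ω)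
      - (1 - p) * ∫ s in Ioc 0 t, Function.leftLim (fun r => U r ω) s ∂S.measure

/-- The information up to time `t` in the data of the equation: the σ-algebra generated by the
initial value `ξ`, by `X_s` and `N_s` for `s ≤ t`, and by the `P`-null sets. -/
abbrev dataSigma (P : Measure Ω) (X : ℝ≥0 → Ω → ℝ) (N : ℝ≥0 → Ω → ℕ) (ξ : Ω → ℝ) (t : ℝ≥0) :
    MeasurableSpace Ω :=
  MeasurableSpace.comap ξ inferInstance
    ⊔ (⨆ s : Set.Iic t, MeasurableSpace.comap (X s) inferInstance
        ⊔ MeasurableSpace.comap (N s) inferInstance)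
    ⊔ MeasurableSpace.generateFrom {A : Set Ω | P A = 0}

/-- A strong solution: a solution that is adapted to the completed filtration generated by the
initial value and the driving processes. -/
structure IsStrongSolution (𝓕 : Filtration ℝ≥0 mΩ) (P : Measure Ω) (p : ℝ) (X : ℝ≥0 → Ω → ℝ)
    (N : ℝ≥0 → Ω → ℕ) (ξ : Ω → ℝ) (U : ℝ≥0 → Ω → ℝ) : Prop
    extends IsSolution 𝓕 P p X N ξ U where
  strong : ∀ t, Measurable[dataSigma P X N ξ t] (U t)

/-- A (conservative) Markov transition semigroup on `ℝ`. -/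
structure IsTransitionSemigroup (κ : ℝ≥0 → Kernel ℝ ℝ) : Prop where
  markov : ∀ t, IsMarkovKernel (κ t)
  zero : κ 0 = Kernel.id
  add : ∀ s t, κ (s + t) = κ t ∘ₖ κ s

/-- `U` is a strong Markov process relative to `𝓕` with transition semigroup `κ`: for every
stopping time `τ` (possibly infinite), every `t ≥ 0` and every Borel set `B`,
`P(U_{τ+t} ∈ B | 𝓕_τ) = κ_t(U_τ, B)` almost surely on `{τ < ∞}`. -/
structure IsStrongMarkov (𝓕 : Filtration ℝ≥0 mΩ) (P : Measure Ω) (κ : ℝ≥0 → Kernel ℝ ℝ)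
    (U : ℝ≥0 → Ω → ℝ) : Prop where
  semigroup : IsTransitionSemigroup κ
  adapted : Adapted 𝓕 U
  strongMarkov : ∀ (τ : Ω → WithTop ℝ≥0) (hτ : IsStoppingTime 𝓕 τ) (t : ℝ≥0) (B : Set ℝ),
    MeasurableSet B →
      P[{ω | τ ω ≠ ⊤ ∧ U ((τ ω).untopA + t) ω ∈ B}.indicator (fun _ => (1 : ℝ)) |
          hτ.measurableSpace]
        =ᵐ[P] {ω | τ ω ≠ ⊤}.indicator (fun ω => (κ t (U (τ ω).untopA ω)).real B)

end PartialResetting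

/-!
Along a fixed càdlàg path `x` and a fixed counting path `n`, the equation is a finite recursion: the
Stieltjes integral against `n` is a sum over jump times (`IsCountingPath.integral_stieltjes`), so a
solution is determined by its left limits at these times, and the recursion for them gives existence
(`isPathSolution_pathSol`).

Everything else rests on one fact (`IsPathSolution.tendsto_euler`): the Euler scheme started at time
`s` from the value of a solution converges, path by path, to the value of this solution at time
`s + t`. Applied with `s = 0`, it gives uniqueness, and it shows that the solution is measurable in
the initial value and in the driving paths up to the current time. It also reduces the Markov
property at a deterministic time (`setIntegral_comp_add`) to that of the Euler scheme, which holds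
because the increments of `(X, N)` are independent of the past with a law that depends only on the
length of the time interval.

For this, `X` and `N` must have increments *jointly* independent of the past
(`indep_pairIncrement`), while only the increments of each of them are assumed to be so, besides the
independence of `X` and `N`. The interval is cut into small steps. If `a` and `b` are characters of
the increments of `X` and of `N` over one step, then `E[Z a b]` differs from `E[Z] E[a] E[b]`, for
`Z` in the past with `|Z| ≤ 1`, by at most `E|a - E a| E|b - E b|`. The second factor is linear in
the length of the step and the first one tends to zero, so the sum of the errors vanishes in the
limit.

Finally, the solution is Lipschitz in its initial value, so its transition kernels, the laws of the
solutions started from constants, are Feller. With right-continuity of paths, the Markov property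
then extends from deterministic times to stopping times, through approximation from the right by
stopping times with countably many values (`setIntegral_comp_stoppingTime_add`).
-/

namespace PartialResetting

/-! ### Counting paths and their jump times -/

/-- A counting path: a nondecreasing right-continuous path in `ℕ` started at `0`. Jumps of size
larger than one are allowed. -/
structure IsCountingPath (n : ℝ≥0 → ℕ) : Prop where
  monotone : Monotone n
  rightCts : ∀ t, ContinuousWithinAt n (Ici t) t
  zero : n 0 = 0

/-- The first time at which the path `n` exceeds `j`. A jump of size `m` produces `m` equal
consecutive jump times; if `n` never exceeds `j`, the value is the junk value `sInf ∅ = 0`. -/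
noncomputable def jumpTime (n : ℝ≥0 → ℕ) (j : ℕ) : ℝ≥0 := sInf {s | j < n s}

namespace IsCountingPath

variable {n : ℝ≥0 → ℕ}

lemma eventually_eq_right (hn : IsCountingPath n) (t : ℝ≥0) : ∀ᶠ s in 𝓝[≥] t, n s = n t := by
  have h := hn.rightCts t
  rw [ContinuousWithinAt, nhds_discrete, tendsto_pure] at h
  exact h

lemma eventually_eq_left (hn : IsCountingPath n) (t : ℝ≥0) :
    ∀ᶠ s in 𝓝[<] t, n s = Function.leftLim n t := by
  have h := hn.monotone.tendsto_leftLim t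
  rwa [nhds_discrete, tendsto_pure] at h

lemma jumpTime_le (j : ℕ) {a : ℝ≥0} (h : j < n a) : jumpTime n j ≤ a :=
  csInf_le' h

lemma lt_apply_jumpTime (hn : IsCountingPath n) {j : ℕ} {a : ℝ≥0} (h : j < n a) :
    j < n (jumpTime n j) := by
  obtain ⟨b, hb, hb'⟩ := mem_nhdsGE_iff_exists_Ico_subset.1 (hn.eventually_eq_right (jumpTime n j))
  obtain ⟨s, hs, hsb⟩ := exists_lt_of_csInf_lt (s := {s | j < n s}) ⟨a, h⟩ hb
  have : n s = n (jumpTime n j) := hb' ⟨jumpTime_le j hs, hsb⟩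
  exact this ▸ hs

lemma jumpTime_le_iff (hn : IsCountingPath n) {j : ℕ} {a b : ℝ≥0} (h : j < n a) :
    jumpTime n j ≤ b ↔ j < n b :=
  ⟨fun hb => (hn.lt_apply_jumpTime h).trans_le (hn.monotone hb), jumpTime_le j⟩

lemma jumpTime_pos (hn : IsCountingPath n) {j : ℕ} {a : ℝ≥0} (h : j < n a) :
    0 < jumpTime n j := by
  rw [← not_le, hn.jumpTime_le_iff h, hn.zero]
  simp

lemma leftLim_jumpTime_le (hn : IsCountingPath n) {j : ℕ} {a : ℝ≥0} (h : j < n a) :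
    Function.leftLim n (jumpTime n j) ≤ j := by
  have : (𝓝[<] jumpTime n j).NeBot := nhdsLT_neBot_of_exists_lt ⟨0, hn.jumpTime_pos h⟩
  obtain ⟨s, hs, hlt⟩ :=
    ((hn.eventually_eq_left (jumpTime n j)).and self_mem_nhdsWithin).exists
  rw [← hs, ← not_lt]
  exact fun hj => not_le.2 hlt (jumpTime_le j hj)

lemma lt_leftLim_iff (hn : IsCountingPath n) {i : ℕ} {a t : ℝ≥0} (h : i < n a) :
    i < Function.leftLim n t ↔ jumpTime n i < t := by
  rcases eq_or_ne t 0 with rfl | ht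
  · have : Function.leftLim n (0 : ℝ≥0) = n 0 :=
      leftLim_eq_of_eq_bot _ (by simp)
    simp [this, hn.zero]
  have : (𝓝[<] t).NeBot := nhdsLT_neBot_of_exists_lt ⟨0, pos_iff_ne_zero.2 ht⟩
  constructor
  · intro hi
    obtain ⟨s, hs, hlt⟩ := ((hn.eventually_eq_left t).and self_mem_nhdsWithin).exists
    exact (jumpTime_le i (hs ▸ hi)).trans_lt hlt
  · intro hi
    obtain ⟨s, hs, hlt⟩ := ((hn.eventually_eq_left t).and (Ioo_mem_nhdsLT hi)).exists
    rw [← hs]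
    exact (hn.jumpTime_le_iff h).1 hlt.1.le

/-- The Lebesgue-Stieltjes integral against a counting path is the sum over its jump times. -/
lemma integral_stieltjes (hn : IsCountingPath n) {S : StieltjesFunction ℝ≥0}
    (hS : ∀ s, S s = (n s : ℝ)) (f : ℝ≥0 → ℝ) (t : ℝ≥0) :
    ∫ s in Ioc 0 t, f s ∂S.measure = ∑ j ∈ Finset.range (n t), f (jumpTime n j) := by
  have key : S.measure.restrict (Ioc 0 t)
      = ∑ j ∈ Finset.range (n t), Measure.dirac (jumpTime n j) := by
    have : IsFiniteMeasure (S.measure.restrict (Ioc 0 t)) := by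
      constructor
      simp [S.measure_Ioc]
    refine Measure.ext_of_Iic _ _ fun a => ?_
    have h1 : Iic a ∩ Ioc 0 t = Ioc 0 (min a t) := by
      ext s; simp only [mem_inter_iff, mem_Iic, mem_Ioc, le_min_iff]; tauto
    have h2 : ∀ j ∈ Finset.range (n t), Measure.dirac (jumpTime n j) (Iic a)
        = if j < n a then 1 else 0 := by
      intro j hj
      rw [Measure.dirac_apply' _ measurableSet_Iic, Set.indicator_apply]
      simp only [mem_Iic, hn.jumpTime_le_iff (Finset.mem_range.1 hj), Pi.one_apply]
    rw [Measure.restrict_apply measurableSet_Iic, h1, S.measure_Ioc, hS, hS, hn.zero,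
      Measure.finsetSum_apply, Finset.sum_congr rfl h2, Finset.sum_ite,
      hn.monotone.map_min]
    have h3 : (Finset.range (n t)).filter (fun j => j < n a) = Finset.range (min (n a) (n t)) := by
      ext j; simp only [Finset.mem_filter, Finset.mem_range, lt_min_iff]; tauto
    simpa [h3] using (Nat.mono_cast.map_min).symm
  rw [key, integral_finsetSum_measure fun j _ => integrable_dirac (by simp)]
  simp

end IsCountingPath

/-! ### Solutions along a path -/

lemma IsCadlag.tendsto_leftLim {f : ℝ≥0 → ℝ} (hf : IsCadlag f) {t : ℝ≥0} (ht : 0 < t) :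
    Tendsto f (𝓝[<] t) (𝓝 (Function.leftLim f t)) := by
  have : (𝓝[<] t).NeBot := nhdsLT_neBot_of_exists_lt ⟨0, ht⟩
  obtain ⟨l, hl⟩ := hf.2 t
  rwa [leftLim_eq_of_tendsto hl]

/-- `u` solves, along the driving path `x` and the counting path `n`, the resetting equation
started at `y`; the integral against `n` is written as a sum over jump times. -/
structure IsPathSolution (p : ℝ) (x : ℝ≥0 → ℝ) (n : ℝ≥0 → ℕ) (y : ℝ) (u : ℝ≥0 → ℝ) : Prop where
  cadlag : IsCadlag u
  eq : ∀ t, u t = y + (x t - x 0)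
    - (1 - p) * ∑ j ∈ Finset.range (n t), Function.leftLim u (jumpTime n j)

/-- The left limits of the solution at the successive jump times, computed recursively. With
repeated jump times, only strictly earlier ones count, whence the condition in the sum. -/
noncomputable def preJump (p : ℝ) (x : ℝ≥0 → ℝ) (n : ℝ≥0 → ℕ) (y : ℝ) (m : ℕ) : ℝ :=
  y + (Function.leftLim x (jumpTime n m) - x 0)
    - (1 - p) * ∑ j : Fin m, if jumpTime n j < jumpTime n m then preJump p x n y j else 0
termination_by m
decreasing_by exact j.2

/-- The solution along a path, written through its values just before the jump times. -/
noncomputable def pathSol (p : ℝ) (x : ℝ≥0 → ℝ) (n : ℝ≥0 → ℕ) (y : ℝ) (t : ℝ≥0) : ℝ :=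
  y + (x t - x 0) - (1 - p) * ∑ j ∈ Finset.range (n t), preJump p x n y j

lemma isPathSolution_pathSol (p : ℝ) {x : ℝ≥0 → ℝ} {n : ℝ≥0 → ℕ} (hx : IsCadlag x)
    (hn : IsCountingPath n) (y : ℝ) : IsPathSolution p x n y (pathSol p x n y) := by
  have hleft : ∀ t, 0 < t → Tendsto (pathSol p x n y) (𝓝[<] t)
      (𝓝 (y + (Function.leftLim x t - x 0)
        - (1 - p) * ∑ j ∈ Finset.range (Function.leftLim n t), preJump p x n y j)) := by
    intro t ht
    refine Tendsto.sub (((hx.tendsto_leftLim ht).sub_const _).const_add _) ?_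
    refine tendsto_const_nhds.congr' ?_
    filter_upwards [hn.eventually_eq_left t] with s hs
    rw [hs]
  refine ⟨⟨fun t => ?_, fun t => ?_⟩, fun t => ?_⟩
  · refine ContinuousWithinAt.sub ((((hx.1 t).sub_const (x 0))).const_add y) ?_
    refine ContinuousWithinAt.congr_of_eventuallyEq continuousWithinAt_const ?_ rfl
    filter_upwards [hn.eventually_eq_right t] with s hs
    rw [hs]
  · rcases eq_or_ne t 0 with rfl | ht
    · exact ⟨0, by simp⟩
    · exact ⟨_, hleft t (pos_iff_ne_zero.2 ht)⟩
  · rw [pathSol]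
    congr 2
    refine Finset.sum_congr rfl fun m hm => ?_
    rw [Finset.mem_range] at hm
    have : (𝓝[<] jumpTime n m).NeBot := nhdsLT_neBot_of_exists_lt ⟨0, hn.jumpTime_pos hm⟩
    rw [leftLim_eq_of_tendsto (hleft _ (hn.jumpTime_pos hm)), preJump,
      Fin.sum_univ_eq_sum_range
        (fun j => if jumpTime n j < jumpTime n m then preJump p x n y j else 0) m,
      ← Finset.sum_filter]
    congr 2
    refine Finset.sum_congr ?_ fun _ _ => rfl
    ext j
    have hle := hn.leftLim_jumpTime_le hm
    simp only [Finset.mem_filter, Finset.mem_range]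
    constructor
    · rintro ⟨hj, hlt⟩
      exact (hn.lt_leftLim_iff (hj.trans hm)).2 hlt
    · intro hj
      have hjm := hj.trans_le hle
      exact ⟨hjm, (hn.lt_leftLim_iff (hjm.trans hm)).1 hj⟩

/-! ### The Euler scheme -/

/-- The increment over `[a, a + h]` of the pair of driving paths. -/
def increment (x : ℝ≥0 → ℝ) (n : ℝ≥0 → ℕ) (a h : ℝ≥0) : ℝ × ℝ :=
  (x (a + h) - x a, ((n (a + h) - n a : ℕ) : ℝ))

/-- One step of the Euler scheme from `y`, for the increment `z` of the driving pair. -/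
def eulerStep (p y : ℝ) (z : ℝ × ℝ) : ℝ := y + z.1 - (1 - p) * y * z.2

/-- The Euler scheme with step `h`, started from `y` at time `s`, after `k` steps. -/
noncomputable def euler (p : ℝ) (x : ℝ≥0 → ℝ) (n : ℝ≥0 → ℕ) (s h : ℝ≥0) (y : ℝ) : ℕ → ℝ
  | 0 => y
  | k + 1 => eulerStep p (euler p x n s h y k) (increment x n (s + k * h) h)

lemma abs_one_sub_mul_le {p : ℝ} (hp : p ∈ Ioo (0 : ℝ) 1) {d : ℝ} (hd : 0 ≤ d) :
    |1 - (1 - p) * d| ≤ 1 + d := by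
  obtain ⟨h0, h1⟩ := hp
  rw [abs_le]
  constructor <;> nlinarith [mul_nonneg h0.le hd]

lemma one_add_natCast_le_two_pow (d : ℕ) : 1 + (d : ℝ) ≤ 2 ^ d := by
  have : 1 + d ≤ 2 ^ d := by rw [add_comm]; exact Nat.lt_two_pow_self
  exact_mod_cast this

lemma gridPoint_succ (s h : ℝ≥0) (k : ℕ) : s + ((k + 1 : ℕ) : ℝ≥0) * h = s + k * h + h := by
  push_cast; ring

lemma gridPoint_last (s t : ℝ≥0) (m : ℕ) :
    s + ((m + 1 : ℕ) : ℝ≥0) * (t / ((m : ℝ≥0) + 1)) = s + t := by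
  push_cast
  rw [mul_div_cancel₀]
  positivity

lemma tendsto_div_add_one_nhds_zero (t : ℝ≥0) :
    Tendsto (fun m : ℕ => t / ((m : ℝ≥0) + 1)) atTop (𝓝 0) := by
  have h1 : Tendsto (fun m : ℕ => t * (1 / ((m : ℝ≥0) + 1))) atTop (𝓝 (t * 0)) :=
    tendsto_one_div_add_atTop_nhds_zero_nat.const_mul t
  simpa [div_eq_mul_inv] using h1

/-- The Euler scheme is Lipschitz in its initial value, uniformly in the step. -/
lemma abs_euler_sub_euler_le {p : ℝ} (hp : p ∈ Ioo (0 : ℝ) 1) (x : ℝ≥0 → ℝ) {n : ℝ≥0 → ℕ}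
    (hn : Monotone n) (s h : ℝ≥0) (y z : ℝ) (k : ℕ) :
    |euler p x n s h y k - euler p x n s h z k| ≤ 2 ^ (n (s + k * h) - n s) * |y - z| := by
  induction k with
  | zero => simp [euler]
  | succ k ih =>
    set d := n (s + k * h + h) - n (s + k * h) with hd
    have h1 : n s ≤ n (s + k * h) := hn (by simp)
    have h2 : n (s + k * h) ≤ n (s + k * h + h) := hn (by simp)
    have e : euler p x n s h y (k + 1) - euler p x n s h z (k + 1)
        = (1 - (1 - p) * d) * (euler p x n s h y k - euler p x n s h z k) := by
      simp only [euler, eulerStep, increment, ← hd]; ring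
    rw [e, abs_mul, gridPoint_succ,
      show n (s + k * h + h) - n s = d + (n (s + k * h) - n s) by omega, pow_add, mul_assoc]
    gcongr
    exact (abs_one_sub_mul_le hp (Nat.cast_nonneg d)).trans (one_add_natCast_le_two_pow d)

namespace IsPathSolution

variable {p y : ℝ} {x : ℝ≥0 → ℝ} {n : ℝ≥0 → ℕ} {u : ℝ≥0 → ℝ}

lemma sub_eq (hu : IsPathSolution p x n y u) (hn : Monotone n) {a b : ℝ≥0} (hab : a ≤ b) :
    u b - u a = x b - x a
      - (1 - p) * ∑ j ∈ Finset.Ico (n a) (n b), Function.leftLim u (jumpTime n j) := by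
  rw [Finset.sum_Ico_eq_sub _ (hn hab), hu.eq b, hu.eq a]
  ring

/-- One step of the error recursion: a step of the Euler scheme over which `n` increases by `d`
multiplies the distance to the solution, augmented by `ε`, by at most `2 ^ d`, as soon as the
solution is within `ε` of its value at the left end point just before the jumps of this step. -/
lemma abs_eulerStep_sub_add_le (hu : IsPathSolution p x n y u) (hn : Monotone n)
    (hp : p ∈ Ioo (0 : ℝ) 1) {a h : ℝ≥0} {ε : ℝ} (hε : 0 ≤ ε)
    (hj : ∀ j ∈ Finset.Ico (n a) (n (a + h)), |Function.leftLim u (jumpTime n j) - u a| ≤ ε)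
    (e : ℝ) :
    |eulerStep p e (increment x n a h) - u (a + h)| + ε
      ≤ 2 ^ (n (a + h) - n a) * (|e - u a| + ε) := by
  set d := n (a + h) - n a with hd
  have hsum : |∑ j ∈ Finset.Ico (n a) (n (a + h)),
      (Function.leftLim u (jumpTime n j) - u a)| ≤ d * ε := by
    refine (Finset.abs_sum_le_sum_abs _ _).trans ((Finset.sum_le_sum hj).trans ?_)
    simp [hd]
  have e1 : eulerStep p e (increment x n a h) - u (a + h)
      = (1 - (1 - p) * d) * (e - u a) + (1 - p) * ∑ j ∈ Finset.Ico (n a) (n (a + h)),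
      (Function.leftLim u (jumpTime n j) - u a) := by
    have := hu.sub_eq hn (a := a) (b := a + h) (by simp)
    simp only [eulerStep, increment, ← hd, Finset.sum_sub_distrib, Finset.sum_const, Nat.card_Ico,
      nsmul_eq_mul]
    linear_combination -this
  have h1 : |eulerStep p e (increment x n a h) - u (a + h)|
      ≤ (1 + d) * |e - u a| + d * ε := by
    rw [e1]
    refine (abs_add_le _ _).trans ?_
    rw [abs_mul, abs_mul]
    have hp' : |1 - p| ≤ 1 := by rw [abs_le]; constructor <;> linarith [hp.1, hp.2]
    refine add_le_add (mul_le_mul_of_nonneg_right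
      (abs_one_sub_mul_le hp (Nat.cast_nonneg d)) (abs_nonneg _)) ?_
    exact (mul_le_of_le_one_left (abs_nonneg _) hp').trans hsum
  calc _ ≤ (1 + d) * (|e - u a| + ε) := by linarith
    _ ≤ _ := mul_le_mul_of_nonneg_right (one_add_natCast_le_two_pow d) (by positivity)

/-- The Euler scheme started at time `s` from the value of a solution converges to the value of
this solution at time `s + t`, as the step `t / (m + 1)` tends to zero. -/
theorem tendsto_euler (hu : IsPathSolution p x n y u) (hn : IsCountingPath n)
    (hp : p ∈ Ioo (0 : ℝ) 1) (s t : ℝ≥0) :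
    Tendsto (fun m : ℕ => euler p x n s (t / (m + 1)) (u s) (m + 1)) atTop (𝓝 (u (s + t))) := by
  have hstep := tendsto_div_add_one_nhds_zero t
  rw [Metric.tendsto_atTop']
  intro η hη
  set C : ℝ := 2 ^ (n (s + t)) with hC
  have hC0 : 0 < C := by positivity
  set ε : ℝ := η / (2 * C) with hεdef
  have hε : 0 < ε := by positivity
  -- Before each of the finitely many jump times, the solution is close to its left limit.
  have hclose : ∀ j ∈ Finset.range (n (s + t)), ∃ δ : ℝ≥0, 0 < δ ∧ ∀ a, a < jumpTime n j →
      jumpTime n j ≤ a + δ → |Function.leftLim u (jumpTime n j) - u a| ≤ ε := by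
    intro j hj
    have hpos := hn.jumpTime_pos (Finset.mem_range.1 hj)
    have h1 := (hu.cadlag.tendsto_leftLim hpos).eventually (Metric.closedBall_mem_nhds _ hε)
    obtain ⟨l, hl, hl'⟩ := (mem_nhdsLT_iff_exists_Ioo_subset' hpos).1 h1
    refine ⟨(jumpTime n j - l) / 2, half_pos (tsub_pos_of_lt hl), fun a ha ha' => ?_⟩
    have : a ∈ Ioo l (jumpTime n j) := by
      refine ⟨?_, ha⟩
      by_contra! hla
      have h3 : (jumpTime n j - l) / 2 < jumpTime n j - l :=
        NNReal.half_lt_self (tsub_pos_of_lt hl).ne'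
      have h4 : a + (jumpTime n j - l) / 2 < l + (jumpTime n j - l) :=
        add_lt_add_of_le_of_lt hla h3
      rw [add_tsub_cancel_of_le (le_of_lt hl)] at h4
      exact absurd ha' (not_le.2 h4)
    have h2 := hl' this
    simpa [Real.dist_eq, abs_sub_comm] using h2
  choose! δ hδ hδ' using hclose
  have hev : ∀ᶠ m : ℕ in atTop, ∀ j ∈ Finset.range (n (s + t)), t / ((m : ℝ≥0) + 1) < δ j := by
    rw [Finset.eventually_all]
    exact fun j hj => hstep.eventually_lt_const (hδ j hj)
  obtain ⟨m₀, hm₀⟩ := eventually_atTop.1 hev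
  refine ⟨m₀, fun m hm => ?_⟩
  set h : ℝ≥0 := t / ((m : ℝ≥0) + 1) with hh
  have hend : s + ((m + 1 : ℕ) : ℝ≥0) * h = s + t := gridPoint_last s t m
  have hind : ∀ k ≤ m + 1, |euler p x n s h (u s) k - u (s + k * h)| + ε
      ≤ 2 ^ (n (s + k * h) - n s) * ε := by
    intro k
    induction k with
    | zero => intro _; simp [euler]
    | succ k ih =>
      intro hk
      have hle : s + k * h + h ≤ s + t := by
        rw [← gridPoint_succ, ← hend]
        gcongr
      have h1 : n s ≤ n (s + k * h) := hn.monotone (by simp)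
      have h2 : n (s + k * h) ≤ n (s + k * h + h) := hn.monotone (by simp)
      rw [gridPoint_succ, show n (s + k * h + h) - n s
        = (n (s + k * h + h) - n (s + k * h)) + (n (s + k * h) - n s) by omega, pow_add, mul_assoc]
      refine (hu.abs_eulerStep_sub_add_le hn.monotone hp hε.le (fun j hj => ?_) _).trans
        (mul_le_mul_of_nonneg_left (ih (by omega)) (by positivity))
      rw [Finset.mem_Ico] at hj
      have hj' : j ∈ Finset.range (n (s + t)) :=
        Finset.mem_range.2 (hj.2.trans_le (hn.monotone hle))
      refine hδ' j hj' _ ?_ ?_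
      · rw [← not_le, hn.jumpTime_le_iff hj.2]; omega
      · exact (IsCountingPath.jumpTime_le j hj.2).trans (by gcongr; exact (hm₀ m hm.le j hj').le)
  have hfin := hind (m + 1) le_rfl
  rw [hend] at hfin
  have hpow : (2 : ℝ) ^ (n (s + t) - n s) ≤ C := by
    rw [hC]; exact pow_le_pow_right₀ (by norm_num) (by omega)
  have : C * ε = η / 2 := by rw [hεdef]; field_simp
  rw [Real.dist_eq]
  nlinarith [mul_le_mul_of_nonneg_right hpow hε.le]

end IsPathSolution

/-! ### Joint independence of the increments of the driving pair -/

/-- The unit complex number `exp (i θ)`. -/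
noncomputable def cis (θ : ℝ) : ℂ := Complex.exp (θ * Complex.I)

@[simp] lemma norm_cis (θ : ℝ) : ‖cis θ‖ = 1 := Complex.norm_exp_ofReal_mul_I θ

lemma cis_add (θ η : ℝ) : cis (θ + η) = cis θ * cis η := by
  simp [cis, add_mul, Complex.exp_add]

@[simp] lemma cis_zero : cis 0 = 1 := by simp [cis]

@[fun_prop] lemma continuous_cis : Continuous cis := by unfold cis; fun_prop

section

variable {Ω : Type*} {m : MeasurableSpace Ω} [mΩ : MeasurableSpace Ω] {P : Measure Ω}
  {𝓕 : Filtration ℝ≥0 mΩ} {X : ℝ≥0 → Ω → ℝ} {rate : ℝ≥0} {N : ℝ≥0 → Ω → ℕ}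

lemma integrable_of_norm_le [IsFiniteMeasure P] {f : Ω → ℂ} (hf : Measurable f) (C : ℝ)
    (hC : ∀ ω, ‖f ω‖ ≤ C) :
    Integrable f P :=
  Integrable.of_bound hf.aestronglyMeasurable C (ae_of_all _ hC)

lemma integral_norm_sub_integral_le [IsProbabilityMeasure P] {f : Ω → ℂ} (hf : Measurable f)
    (hf1 : ∀ ω, ‖f ω‖ ≤ 1) :
    ∫ ω, ‖f ω - ∫ ω', f ω' ∂P‖ ∂P ≤ 2 * ∫ ω, ‖f ω - 1‖ ∂P := by
  have hi := integrable_of_norm_le (P := P) hf 1 hf1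
  have h1 : ‖1 - ∫ ω', f ω' ∂P‖ ≤ ∫ ω, ‖f ω - 1‖ ∂P := by
    have : 1 - ∫ ω', f ω' ∂P = -∫ ω', (f ω' - 1) ∂P := by
      rw [integral_sub hi (integrable_const _)]; simp
    rw [this, norm_neg]
    exact norm_integral_le_integral_norm _
  calc ∫ ω, ‖f ω - ∫ ω', f ω' ∂P‖ ∂P
      ≤ ∫ ω, (‖f ω - 1‖ + ‖1 - ∫ ω', f ω' ∂P‖) ∂P := by
        refine integral_mono (hi.sub (integrable_const _)).norm
          ((hi.sub (integrable_const _)).norm.add (integrable_const _)) fun ω => ?_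
        exact norm_sub_le_norm_sub_add_norm_sub _ _ _
    _ = ∫ ω, ‖f ω - 1‖ ∂P + ‖1 - ∫ ω', f ω' ∂P‖ := by
        have h2 : Integrable (fun ω => ‖f ω - 1‖) P := (hi.sub (integrable_const _)).norm
        rw [integral_add h2 (integrable_const _)]; simp
    _ ≤ _ := by linarith

lemma IsLevyProcess.measurable (hX : IsLevyProcess 𝓕 P X) (t : ℝ≥0) : Measurable (X t) :=
  (hX.adapted t).mono (𝓕.le t) le_rfl

lemma IsPoissonProcess.measurable (hN : IsPoissonProcess 𝓕 P rate N) (t : ℝ≥0) :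
    Measurable (N t) :=
  (hN.adapted t).mono (𝓕.le t) le_rfl

/-- If `A` and `B` are independent of each other, and each of them is independent of `m`, then
`E[Z A B]` differs from `E[Z] E[A] E[B]`, for `Z` measurable with respect to `m`, by at most
`E|A - E A| E|B - E B|`. Joint independence of `(A, B)` from `m` is not assumed. -/
lemma norm_integral_mul_mul_sub_le [IsProbabilityMeasure P] (hm : m ≤ mΩ) {Z A B : Ω → ℂ}
    (hZ : Measurable[m] Z) (hA : Measurable A) (hB : Measurable B)
    (hZ1 : ∀ ω, ‖Z ω‖ ≤ 1) (hA1 : ∀ ω, ‖A ω‖ ≤ 1) (hB1 : ∀ ω, ‖B ω‖ ≤ 1)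
    (hAm : Indep (MeasurableSpace.comap A inferInstance) m P)
    (hBm : Indep (MeasurableSpace.comap B inferInstance) m P) (hAB : IndepFun A B P) :
    ‖∫ ω, Z ω * (A ω * B ω) ∂P - (∫ ω, A ω ∂P) * (∫ ω, B ω ∂P) * ∫ ω, Z ω ∂P‖
      ≤ (∫ ω, ‖A ω - ∫ ω', A ω' ∂P‖ ∂P) * ∫ ω, ‖B ω - ∫ ω', B ω' ∂P‖ ∂P := by
  set a := ∫ ω, A ω ∂P
  set b := ∫ ω, B ω ∂P
  have hZ' : Measurable Z := hZ.mono hm le_rfl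
  have hZA : IndepFun A Z P := by
    rw [IndepFun_iff_Indep]
    exact indep_of_indep_of_le_right hAm hZ.comap_le
  have hZB : IndepFun B Z P := by
    rw [IndepFun_iff_Indep]
    exact indep_of_indep_of_le_right hBm hZ.comap_le
  have iZ := integrable_of_norm_le (P := P) hZ' 1 hZ1
  have iAZ : Integrable (fun ω => A ω * Z ω) P :=
    integrable_of_norm_le (hA.mul hZ') 1 fun ω => by
      rw [norm_mul]; exact mul_le_one₀ (hA1 ω) (norm_nonneg _) (hZ1 ω)
  have iBZ : Integrable (fun ω => B ω * Z ω) P :=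
    integrable_of_norm_le (hB.mul hZ') 1 fun ω => by
      rw [norm_mul]; exact mul_le_one₀ (hB1 ω) (norm_nonneg _) (hZ1 ω)
  have iZAB : Integrable (fun ω => Z ω * (A ω * B ω)) P :=
    integrable_of_norm_le (hZ'.mul (hA.mul hB)) 1 fun ω => by
      rw [norm_mul, norm_mul]
      exact mul_le_one₀ (hZ1 ω) (by positivity) (mul_le_one₀ (hA1 ω) (norm_nonneg _) (hB1 ω))
  have eA := hZA.integral_fun_mul_eq_mul_integral hA.aestronglyMeasurable hZ'.aestronglyMeasurable
  have eB := hZB.integral_fun_mul_eq_mul_integral hB.aestronglyMeasurable hZ'.aestronglyMeasurable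
  have key : ∫ ω, Z ω * (A ω * B ω) ∂P - a * b * ∫ ω, Z ω ∂P
      = ∫ ω, Z ω * ((A ω - a) * (B ω - b)) ∂P := by
    have : ∀ ω, Z ω * ((A ω - a) * (B ω - b))
        = Z ω * (A ω * B ω) - b * (A ω * Z ω) - a * (B ω * Z ω) + a * b * Z ω := fun ω => by ring
    simp_rw [this]
    have i1 : Integrable (fun ω => Z ω * (A ω * B ω) - b * (A ω * Z ω)) P :=
      iZAB.sub (iAZ.const_mul b)
    have i2 : Integrable (fun ω => Z ω * (A ω * B ω) - b * (A ω * Z ω) - a * (B ω * Z ω)) P :=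
      i1.sub (iBZ.const_mul a)
    rw [integral_add i2 (iZ.const_mul (a * b)), integral_sub i1 (iBZ.const_mul a),
      integral_sub iZAB (iAZ.const_mul b), integral_const_mul, integral_const_mul,
      integral_const_mul, eA, eB]
    ring
  have hAB' : IndepFun (fun ω => ‖A ω - a‖) (fun ω => ‖B ω - b‖) P :=
    hAB.comp (φ := fun z => ‖z - a‖) (ψ := fun z => ‖z - b‖) (by fun_prop) (by fun_prop)
  have mA : Measurable fun ω => ‖A ω - a‖ := by fun_prop
  have mB : Measurable fun ω => ‖B ω - b‖ := by fun_prop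
  rw [key, ← hAB'.integral_fun_mul_eq_mul_integral mA.aestronglyMeasurable
    mB.aestronglyMeasurable]
  refine norm_integral_le_of_norm_le (hAB'.integrable_mul
    (((integrable_of_norm_le hA 1 hA1).sub (integrable_const _)).norm)
    (((integrable_of_norm_le hB 1 hB1).sub (integrable_const _)).norm)) (ae_of_all _ fun ω => ?_)
  rw [norm_mul, norm_mul]
  exact mul_le_of_le_one_left (by positivity) (hZ1 ω)

lemma measurable_increment {α : Type*} {m : MeasurableSpace α} {x : ℝ≥0 → α → ℝ}
    {n : ℝ≥0 → α → ℕ} {a h : ℝ≥0} (hx : ∀ r ≤ a + h, Measurable[m] (x r))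
    (hn : ∀ r ≤ a + h, Measurable[m] (n r)) :
    Measurable[m] fun ω => increment (fun t => x t ω) (fun t => n t ω) a h := by
  have h3 : Measurable[m] fun ω => ((n (a + h) ω - n a ω : ℕ) : ℝ) :=
    (measurable_from_top (f := (Nat.cast : ℕ → ℝ))).comp
      ((hn _ le_rfl).sub (hn a (by simp)))
  exact ((hx _ le_rfl).sub (hx a (by simp))).prodMk h3

/-- The increment over `[a, a + h]` of the driving pair of processes. -/
def pairIncrement (X : ℝ≥0 → Ω → ℝ) (N : ℝ≥0 → Ω → ℕ) (a h : ℝ≥0) (ω : Ω) : ℝ × ℝ :=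
  increment (fun t => X t ω) (fun t => N t ω) a h

lemma measurable_pairIncrement (hX : IsLevyProcess 𝓕 P X) (hN : IsPoissonProcess 𝓕 P rate N)
    (a h : ℝ≥0) : Measurable[𝓕 (a + h)] (pairIncrement X N a h) := by
  exact measurable_increment (fun r hr => (hX.adapted r).mono (𝓕.mono hr) le_rfl)
    fun r hr => (hN.adapted r).mono (𝓕.mono hr) le_rfl

/-- The law of an increment of the driving pair depends only on the length of the time interval. -/
lemma map_pairIncrement [IsProbabilityMeasure P] (hX : IsLevyProcess 𝓕 P X)
    (hN : IsPoissonProcess 𝓕 P rate N)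
    (hXN : IndepFun (fun ω t => X t ω) (fun ω t => N t ω) P) (a h : ℝ≥0) :
    P.map (pairIncrement X N a h) = (P.map fun ω => X h ω - X 0 ω).prod
      ((poissonMeasure (rate * h)).map (Nat.cast : ℕ → ℝ)) := by
  have hm1 : Measurable fun ω => X (a + h) ω - X a ω := (hX.measurable _).sub (hX.measurable _)
  have hm2 : Measurable fun ω => N (a + h) ω - N a ω := (hN.measurable _).sub (hN.measurable _)
  have hm3 : Measurable fun ω => ((N (a + h) ω - N a ω : ℕ) : ℝ) :=
    (measurable_from_top (f := (Nat.cast : ℕ → ℝ))).comp hm2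
  have hind : IndepFun (fun ω => X (a + h) ω - X a ω)
      (fun ω => ((N (a + h) ω - N a ω : ℕ) : ℝ)) P :=
    hXN.comp (φ := fun x : ℝ≥0 → ℝ => x (a + h) - x a)
      (ψ := fun n : ℝ≥0 → ℕ => ((n (a + h) - n a : ℕ) : ℝ))
      (by fun_prop) ((measurable_from_top (f := (Nat.cast : ℕ → ℝ))).comp (by fun_prop))
  have := (indepFun_iff_map_prod_eq_prod_map_map hm1.aemeasurable hm3.aemeasurable).1 hind
  rw [show pairIncrement X N a h = fun ω => (X (a + h) ω - X a ω,
    ((N (a + h) ω - N a ω : ℕ) : ℝ)) from rfl, this, hX.stationary,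
    ← add_tsub_cancel_left a h, ← hN.law a (a + h) (by simp), add_tsub_cancel_left,
    Measure.map_map (g := (Nat.cast : ℕ → ℝ)) measurable_from_top hm2]
  rfl

/-- The phase along which characters of the driving pair are evaluated. -/
def phase (X : ℝ≥0 → Ω → ℝ) (N : ℝ≥0 → Ω → ℕ) (u v : ℝ) (t : ℝ≥0) (ω : Ω) : ℝ :=
  u * X t ω + v * N t ω

lemma measurable_phase (hX : IsLevyProcess 𝓕 P X) (hN : IsPoissonProcess 𝓕 P rate N) (u v : ℝ)
    (t : ℝ≥0) : Measurable[𝓕 t] (phase X N u v t) := by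
  have h3 : Measurable[𝓕 t] fun ω => (N t ω : ℝ) :=
    (measurable_from_top (f := (Nat.cast : ℕ → ℝ))).comp (hN.adapted t)
  exact ((hX.adapted t).const_mul u).add (h3.const_mul v)

lemma phase_sub_ae (hN : IsPoissonProcess 𝓕 P rate N) (u v : ℝ) (a h : ℝ≥0) :
    ∀ᵐ ω ∂P, phase X N u v (a + h) ω - phase X N u v a ω
      = u * (pairIncrement X N a h ω).1 + v * (pairIncrement X N a h ω).2 := by
  filter_upwards [hN.monotone] with ω hω
  have : N a ω ≤ N (a + h) ω := hω (by simp)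
  simp only [phase, pairIncrement, increment]
  push_cast [Nat.cast_sub this]
  ring

/-- The mean oscillation of the character of frequency `u` over a time step `h` of `X`. -/
noncomputable def levyOsc (P : Measure Ω) (X : ℝ≥0 → Ω → ℝ) (u : ℝ) (h : ℝ≥0) : ℝ :=
  ∫ z, ‖cis (u * z) - 1‖ ∂(P.map fun ω => X h ω - X 0 ω)

lemma tendsto_levyOsc [IsProbabilityMeasure P] (hX : IsLevyProcess 𝓕 P X) (u : ℝ) {h : ℕ → ℝ≥0}
    (hh : Tendsto h atTop (𝓝 0)) : Tendsto (fun m => levyOsc P X u (h m)) atTop (𝓝 0) := by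
  have hmeas : ∀ t, Measurable fun ω => X t ω - X 0 ω := fun t =>
    (hX.measurable t).sub (hX.measurable 0)
  have hcont : Continuous fun z : ℝ => ‖cis (u * z) - 1‖ :=
    ((continuous_cis.comp (continuous_const_mul u)).sub continuous_const).norm
  have e : ∀ t, levyOsc P X u t = ∫ ω, ‖cis (u * (X t ω - X 0 ω)) - 1‖ ∂P := fun t =>
    integral_map (hmeas t).aemeasurable hcont.aestronglyMeasurable
  simp_rw [e]
  rw [show (0 : ℝ) = ∫ _, (0 : ℝ) ∂P by simp]
  refine tendsto_integral_of_dominated_convergence (fun _ => 2)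
    (fun m => (hcont.measurable.comp (hmeas (h m))).aestronglyMeasurable) (integrable_const _)
    (fun m => ae_of_all _ fun ω => ?_) ?_
  · rw [norm_norm]
    refine (norm_sub_le _ _).trans ?_
    rw [norm_cis]; norm_num
  · filter_upwards [hX.cadlag] with ω hω
    have h1 : Tendsto (fun m => X (h m) ω) atTop (𝓝 (X 0 ω)) := by
      refine Tendsto.comp (hω.1 0) (tendsto_nhdsWithin_iff.2 ⟨hh, ?_⟩)
      exact Eventually.of_forall fun m => mem_Ici.2 zero_le
    have h2 : Tendsto (fun m => X (h m) ω - X 0 ω) atTop (𝓝 0) := by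
      simpa using h1.sub_const (X 0 ω)
    have h3 := (hcont.tendsto 0).comp h2
    simpa [Function.comp_def] using h3

/-- The mean oscillation of a character of a Poisson increment is at most linear in the length of
the time interval. -/
lemma integral_norm_cis_poisson_le (r : ℝ≥0) (v : ℝ) :
    ∫ j, ‖cis (v * (j : ℕ)) - 1‖ ∂(poissonMeasure r) ≤ 2 * r := by
  have h1 : ∀ j : ℕ, ‖cis (v * j) - 1‖ ≤ ({0}ᶜ : Set ℕ).indicator (fun _ => (2 : ℝ)) j := by
    intro j
    rcases eq_or_ne j 0 with rfl | hj
    · simp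
    · rw [Set.indicator_of_mem (by simpa using hj)]
      refine (norm_sub_le _ _).trans ?_
      rw [norm_cis]; norm_num
  calc ∫ j, ‖cis (v * (j : ℕ)) - 1‖ ∂(poissonMeasure r)
      ≤ ∫ j, ({0}ᶜ : Set ℕ).indicator (fun _ => (2 : ℝ)) j ∂(poissonMeasure r) := by
        refine integral_mono_of_nonneg (ae_of_all _ fun _ => norm_nonneg _)
          ((integrable_const _).indicator (measurableSet_singleton 0).compl) (ae_of_all _ h1)
    _ = 2 * (1 - Real.exp (-r)) := by
        rw [integral_indicator_const _ (measurableSet_singleton 0).compl,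
          probReal_compl_eq_one_sub (measurableSet_singleton 0), poissonMeasure_real_singleton]
        simp [mul_comm]
    _ ≤ 2 * r := by
        have := Real.add_one_le_exp (-(r : ℝ))
        linarith

/-- Over a time step `h`, the character of the driving pair is multiplied in conditional mean, up
to a small error, by a constant that does not depend on the past. -/
lemma norm_integral_mul_cis_sub_le [IsProbabilityMeasure P] (hX : IsLevyProcess 𝓕 P X)
    (hN : IsPoissonProcess 𝓕 P rate N)
    (hXN : IndepFun (fun ω t => X t ω) (fun ω t => N t ω) P) (u v : ℝ) (h : ℝ≥0) :
    ∃ c : ℂ, ‖c‖ ≤ 1 ∧ ∀ (a : ℝ≥0) (Z : Ω → ℂ), Measurable[𝓕 a] Z → (∀ ω, ‖Z ω‖ ≤ 1) →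
      ‖∫ ω, Z ω * cis (phase X N u v (a + h) ω - phase X N u v a ω) ∂P - c * ∫ ω, Z ω ∂P‖
        ≤ 8 * (rate * h) * levyOsc P X u h := by
  have hcu : Measurable fun z : ℝ => cis (u * z) :=
    (continuous_cis.comp (continuous_const_mul u)).measurable
  have hcv : Measurable fun j : ℕ => cis (v * j) := measurable_from_top
  refine ⟨(∫ z, cis (u * z) ∂(P.map fun ω => X h ω - X 0 ω))
    * ∫ j, cis (v * (j : ℕ)) ∂(poissonMeasure (rate * h)), ?_, fun a Z hZ hZ1 => ?_⟩
  · have : IsProbabilityMeasure (P.map fun ω => X h ω - X 0 ω) :=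
      Measure.isProbabilityMeasure_map
        ((hX.measurable h).sub (hX.measurable 0)).aemeasurable
    rw [norm_mul]
    refine mul_le_one₀ ?_ (norm_nonneg _) ?_
    · exact (norm_integral_le_integral_norm _).trans (by simp)
    · exact (norm_integral_le_integral_norm _).trans (by simp)
  set D : Ω → ℝ := fun ω => X (a + h) ω - X a ω with hD
  set E : Ω → ℕ := fun ω => N (a + h) ω - N a ω with hE
  have hDm : Measurable D := (hX.measurable _).sub (hX.measurable _)
  have hEm : Measurable E := (hN.measurable _).sub (hN.measurable _)
  have hlawD : P.map D = P.map fun ω => X h ω - X 0 ω := hX.stationary a h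
  have hlawE : P.map E = poissonMeasure (rate * h) := by
    rw [hE, hN.law a (a + h) (by simp), add_tsub_cancel_left]
  have hAm : Measurable fun ω => cis (u * D ω) := hcu.comp hDm
  have hBm : Measurable fun ω => cis (v * E ω) := hcv.comp hEm
  have hAB : IndepFun (fun ω => cis (u * D ω)) (fun ω => cis (v * E ω)) P :=
    hXN.comp (φ := fun x : ℝ≥0 → ℝ => cis (u * (x (a + h) - x a)))
      (ψ := fun n : ℝ≥0 → ℕ => cis (v * (n (a + h) - n a : ℕ)))
      (hcu.comp (by fun_prop)) (hcv.comp (by fun_prop))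
  have hA0 : Indep (MeasurableSpace.comap (fun ω => cis (u * D ω)) inferInstance) (𝓕 a) P :=
    indep_of_indep_of_le_left (hX.indep a (a + h) (by simp))
      (hcu.comp (comap_measurable D)).comap_le
  have hB0 : Indep (MeasurableSpace.comap (fun ω => cis (v * E ω)) inferInstance) (𝓕 a) P :=
    indep_of_indep_of_le_left (hN.indep a (a + h) (by simp))
      (hcv.comp (comap_measurable E)).comap_le
  have main := norm_integral_mul_mul_sub_le (𝓕.le a) hZ hAm hBm hZ1 (fun ω => (norm_cis _).le)
    (fun ω => (norm_cis _).le) hA0 hB0 hAB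
  have eA : ∫ ω, cis (u * D ω) ∂P = ∫ z, cis (u * z) ∂(P.map fun ω => X h ω - X 0 ω) := by
    rw [← hlawD, integral_map hDm.aemeasurable hcu.aestronglyMeasurable]
  have eB : ∫ ω, cis (v * E ω) ∂P = ∫ j, cis (v * (j : ℕ)) ∂(poissonMeasure (rate * h)) := by
    rw [← hlawE, integral_map hEm.aemeasurable hcv.aestronglyMeasurable]
  have oA : ∫ ω, ‖cis (u * D ω) - 1‖ ∂P = levyOsc P X u h := by
    rw [levyOsc, ← hlawD, integral_map hDm.aemeasurable (by fun_prop)]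
  have oB : ∫ ω, ‖cis (v * E ω) - 1‖ ∂P ≤ 2 * (rate * h) := by
    have := integral_norm_cis_poisson_le (rate * h) v
    rw [← hlawE, integral_map hEm.aemeasurable (by fun_prop)] at this
    simpa using this
  have bA := integral_norm_sub_integral_le (P := P) hAm fun ω => (norm_cis _).le
  have bB := integral_norm_sub_integral_le (P := P) hBm fun ω => (norm_cis _).le
  have hphase : ∫ ω, Z ω * cis (phase X N u v (a + h) ω - phase X N u v a ω) ∂P
      = ∫ ω, Z ω * (cis (u * D ω) * cis (v * E ω)) ∂P := by
    refine integral_congr_ae ?_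
    filter_upwards [phase_sub_ae (X := X) hN u v a h] with ω hω
    rw [hω, cis_add]
    rfl
  rw [hphase, ← eA, ← eB]
  refine main.trans ?_
  rw [oA] at bA
  have h0 : 0 ≤ levyOsc P X u h := integral_nonneg fun _ => norm_nonneg _
  calc _ ≤ (2 * levyOsc P X u h) * (2 * (2 * (rate * h))) := by
        refine mul_le_mul bA (bB.trans (by linarith)) (integral_nonneg fun _ => norm_nonneg _)
          (by positivity)
    _ = _ := by ring

/-- Characters of an increment of the driving pair are uncorrelated with the past. The interval is
cut into `m + 1` equal steps: the errors of `norm_integral_mul_cis_sub_le` add up to a quantity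
that vanishes as `m → ∞`, so that both sides have the limit of `P(A) c_m ^ (m + 1)`. -/
lemma setIntegral_cis_phase [IsProbabilityMeasure P] (hX : IsLevyProcess 𝓕 P X)
    (hN : IsPoissonProcess 𝓕 P rate N)
    (hXN : IndepFun (fun ω t => X t ω) (fun ω t => N t ω) P) (u v : ℝ) (s t : ℝ≥0)
    {A : Set Ω} (hA : MeasurableSet[𝓕 s] A) :
    ∫ ω in A, cis (phase X N u v (s + t) ω - phase X N u v s ω) ∂P
      = P.real A * ∫ ω, cis (phase X N u v (s + t) ω - phase X N u v s ω) ∂P := by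
  have hstep := tendsto_div_add_one_nhds_zero t
  choose c hc hcZ using norm_integral_mul_cis_sub_le hX hN hXN u v
  have bound : ∀ (B : Set Ω), MeasurableSet[𝓕 s] B → ∀ (h : ℝ≥0) (k : ℕ),
      ‖∫ ω in B, cis (phase X N u v (s + k * h) ω - phase X N u v s ω) ∂P - P.real B * c h ^ k‖
        ≤ k * (8 * (rate * h) * levyOsc P X u h) := by
    intro B hB h k
    have hB' := 𝓕.le s B hB
    induction k with
    | zero => simp
    | succ k ih =>
      set a := s + k * h
      set Z : Ω → ℂ := B.indicator fun ω => cis (phase X N u v a ω - phase X N u v s ω) with hZ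
      have hZm : Measurable[𝓕 a] Z := by
        refine Measurable.indicator ?_ (𝓕.mono (by simp [a]) B hB)
        refine continuous_cis.measurable.comp ((measurable_phase hX hN u v a).sub ?_)
        exact (measurable_phase hX hN u v s).mono (𝓕.mono (by simp [a])) le_rfl
      have hZ1 : ∀ ω, ‖Z ω‖ ≤ 1 := fun ω => by
        by_cases hω : ω ∈ B <;> simp [hZ, hω]
      have hone := hcZ h a Z hZm hZ1
      have e1 : ∫ ω, Z ω * cis (phase X N u v (a + h) ω - phase X N u v a ω) ∂P
          = ∫ ω in B, cis (phase X N u v (a + h) ω - phase X N u v s ω) ∂P := by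
        rw [← integral_indicator hB']
        refine integral_congr_ae (ae_of_all _ fun ω => ?_)
        by_cases hω : ω ∈ B
        · simp only [hZ, Set.indicator_of_mem hω]
          rw [← cis_add]; congr 1; ring
        · simp [hZ, hω]
      have e2 : ∫ ω, Z ω ∂P = ∫ ω in B, cis (phase X N u v a ω - phase X N u v s ω) ∂P :=
        integral_indicator hB'
      rw [e1, e2] at hone
      rw [gridPoint_succ]
      have e3 : ∫ ω in B, cis (phase X N u v (a + h) ω - phase X N u v s ω) ∂P
            - P.real B * c h ^ (k + 1)
          = (∫ ω in B, cis (phase X N u v (a + h) ω - phase X N u v s ω) ∂P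
            - c h * ∫ ω in B, cis (phase X N u v a ω - phase X N u v s ω) ∂P)
            + c h * (∫ ω in B, cis (phase X N u v a ω - phase X N u v s ω) ∂P
              - P.real B * c h ^ k) := by ring
      rw [e3]
      refine (norm_add_le _ _).trans ?_
      rw [norm_mul]
      push_cast
      have := mul_le_of_le_one_left (norm_nonneg (∫ ω in B, cis (phase X N u v a ω
        - phase X N u v s ω) ∂P - P.real B * c h ^ k)) (hc h)
      linarith
  have lim : ∀ (B : Set Ω), MeasurableSet[𝓕 s] B →
      Tendsto (fun m : ℕ => P.real B * c (t / ((m : ℝ≥0) + 1)) ^ (m + 1)) atTop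
        (𝓝 (∫ ω in B, cis (phase X N u v (s + t) ω - phase X N u v s ω) ∂P)) := by
    intro B hB
    rw [tendsto_iff_norm_sub_tendsto_zero]
    have hz : Tendsto (fun m : ℕ => 8 * (rate * t) * levyOsc P X u (t / ((m : ℝ≥0) + 1)))
        atTop (𝓝 0) := by
      simpa using (tendsto_levyOsc hX u hstep).const_mul (8 * (rate * t) : ℝ)
    refine squeeze_zero (fun _ => norm_nonneg _) (fun m => ?_) hz
    have hb := bound B hB (t / ((m : ℝ≥0) + 1)) (m + 1)
    have hend : ((m + 1 : ℕ) : ℝ≥0) * (t / ((m : ℝ≥0) + 1)) = t := by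
      push_cast; rw [mul_div_cancel₀]; positivity
    have hend' : ((m + 1 : ℕ) : ℝ) * ((t / ((m : ℝ≥0) + 1) : ℝ≥0) : ℝ) = t := by
      exact_mod_cast congrArg NNReal.toReal hend
    rw [hend, norm_sub_rev] at hb
    refine hb.trans (le_of_eq ?_)
    rw [← hend']
    ring
  have l1 := lim A hA
  have l2 := (lim univ MeasurableSet.univ).const_mul (P.real A : ℂ)
  simp only [probReal_univ, Complex.ofReal_one, one_mul, Measure.restrict_univ] at l2
  exact tendsto_nhds_unique l1 l2

/-- The increments of `X` and of `N` over an interval are jointly independent of the past. -/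
theorem indep_pairIncrement [IsProbabilityMeasure P] (hX : IsLevyProcess 𝓕 P X)
    (hN : IsPoissonProcess 𝓕 P rate N)
    (hXN : IndepFun (fun ω t => X t ω) (fun ω t => N t ω) P) (s t : ℝ≥0) :
    Indep (MeasurableSpace.comap (pairIncrement X N s t) inferInstance) (𝓕 s) P := by
  have hm : Measurable (pairIncrement X N s t) :=
    (measurable_pairIncrement hX hN s t).mono (𝓕.le _) le_rfl
  have key : ∀ A, MeasurableSet[𝓕 s] A →
      (P.restrict A).map (pairIncrement X N s t) = P A • P.map (pairIncrement X N s t) := by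
    intro A hA
    have : IsFiniteMeasure (P A • P.map (pairIncrement X N s t)) := by
      constructor
      simp [ENNReal.mul_lt_top_iff]
    refine Measure.ext_of_charFunDual (funext fun L => ?_)
    have hLm : AEStronglyMeasurable (fun z : ℝ × ℝ => Complex.exp (L z * Complex.I))
      (P.map (pairIncrement X N s t)) := by fun_prop
    have hL : ∀ᵐ ω ∂P, Complex.exp (L (pairIncrement X N s t ω) * Complex.I)
        = cis (phase X N (L (1, 0)) (L (0, 1)) (s + t) ω
          - phase X N (L (1, 0)) (L (0, 1)) s ω) := by
      filter_upwards [phase_sub_ae (X := X) hN (L (1, 0)) (L (0, 1)) s t] with ω hω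
      rw [hω, cis]
      congr 3
      have : pairIncrement X N s t ω = (pairIncrement X N s t ω).1 • ((1 : ℝ), (0 : ℝ))
          + (pairIncrement X N s t ω).2 • ((0 : ℝ), (1 : ℝ)) := by
        ext <;> simp
      conv_lhs => rw [this]
      rw [map_add, map_smul, map_smul]
      simp [mul_comm]
    rw [charFunDual_apply, charFunDual_apply, integral_smul_measure,
      integral_map hm.aemeasurable (by fun_prop), integral_map hm.aemeasurable hLm,
      integral_congr_ae (ae_restrict_of_ae hL), integral_congr_ae hL,
      setIntegral_cis_phase hX hN hXN _ _ s t hA]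
    rw [← measureReal_def]
    simp
  rw [Indep_iff]
  rintro _ A ⟨B, hB, rfl⟩ hA
  have h := congrArg (fun μ => μ B) (key A hA)
  simp only [Measure.map_apply hm hB, Measure.smul_apply, smul_eq_mul] at h
  rw [Measure.restrict_apply (hm hB)] at h
  rw [h, mul_comm]

end

/-! ### Measurability of the solution -/

/-- If a σ-algebra contains all null sets, then a.e. limits of measurable functions are measurable
without any modification. -/
lemma measurable_of_tendsto_ae_of_null {Ω : Type*} {m : MeasurableSpace Ω}
    [mΩ : MeasurableSpace Ω] {P : Measure Ω} (hnull : ∀ A : Set Ω, P A = 0 → MeasurableSet[m] A)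
    {f : ℕ → Ω → ℝ} {g : Ω → ℝ} (hf : ∀ k, Measurable[m] (f k))
    (h : ∀ᵐ ω ∂P, Tendsto (fun k => f k ω) atTop (𝓝 (g ω))) : Measurable[m] g := by
  set S : Set Ω := {ω | Tendsto (fun k => f k ω) atTop (𝓝 (g ω))} with hS
  have hS0 : P Sᶜ = 0 := h
  have hSm : MeasurableSet[m] S := by
    have := hnull _ hS0
    simpa using this.compl
  have h1 : Measurable[m] (S.indicator g) := by
    refine @measurable_of_tendsto_metrizable _ _ m _ _ _ _ (fun k => S.indicator (f k)) _
      (fun k => (hf k).indicator hSm) (tendsto_pi_nhds.2 fun ω => ?_)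
    by_cases hω : ω ∈ S
    · simp only [Set.indicator_of_mem hω]
      exact hω
    · simp [hω]
  intro B hB
  have e : g ⁻¹' B = (S.indicator g ⁻¹' B ∩ S) ∪ (g ⁻¹' B ∩ Sᶜ) := by
    ext ω
    by_cases hω : ω ∈ S <;> simp [hω]
  rw [e]
  exact ((h1 hB).inter hSm).union
    (hnull _ (measure_mono_null inter_subset_right hS0))

lemma measurable_eulerStep (p : ℝ) : Measurable fun q : ℝ × (ℝ × ℝ) => eulerStep p q.1 q.2 := by
  unfold eulerStep
  fun_prop

lemma measurable_euler {α : Type*} {m : MeasurableSpace α} (p : ℝ) {x : ℝ≥0 → α → ℝ}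
    {n : ℝ≥0 → α → ℕ} {y : α → ℝ} (s h : ℝ≥0) (hy : Measurable[m] y) (k : ℕ)
    (hx : ∀ r ≤ s + k * h, Measurable[m] (x r)) (hn : ∀ r ≤ s + k * h, Measurable[m] (n r)) :
    Measurable[m] fun ω => euler p (fun t => x t ω) (fun t => n t ω) s h (y ω) k := by
  induction k with
  | zero => simpa [euler] using hy
  | succ k ih =>
    rw [gridPoint_succ] at hx hn
    have h1 := ih (fun r hr => hx r (hr.trans (by simp))) (fun r hr => hn r (hr.trans (by simp)))
    exact (measurable_eulerStep p).comp (h1.prodMk (measurable_increment hx hn))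

lemma pathSol_zero (p : ℝ) (x : ℝ≥0 → ℝ) {n : ℝ≥0 → ℕ} (hn : IsCountingPath n) (y : ℝ) :
    pathSol p x n y 0 = y := by
  simp [pathSol, hn.zero]

lemma tendsto_euler_pathSol {p : ℝ} (hp : p ∈ Ioo (0 : ℝ) 1) {x : ℝ≥0 → ℝ} {n : ℝ≥0 → ℕ}
    (hx : IsCadlag x) (hn : IsCountingPath n) (y : ℝ) (t : ℝ≥0) :
    Tendsto (fun m : ℕ => euler p x n 0 (t / (m + 1)) y (m + 1)) atTop
      (𝓝 (pathSol p x n y t)) := by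
  have := (isPathSolution_pathSol p hx hn y).tendsto_euler hn hp 0 t
  rwa [pathSol_zero p x hn, zero_add] at this

/-- The solution along good driving paths, extended by zero, is measurable in all its data up to
the current time. -/
lemma measurable_indicator_pathSol {α : Type*} {m : MeasurableSpace α} {p : ℝ}
    (hp : p ∈ Ioo (0 : ℝ) 1) {x : ℝ≥0 → α → ℝ} {n : ℝ≥0 → α → ℕ} {y : α → ℝ} {G : Set α}
    (hG : MeasurableSet[m] G)
    (hGood : ∀ a ∈ G, IsCadlag (fun t => x t a) ∧ IsCountingPath (fun t => n t a))
    (hy : Measurable[m] y) (t : ℝ≥0) (hx : ∀ r ≤ t, Measurable[m] (x r))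
    (hn : ∀ r ≤ t, Measurable[m] (n r)) :
    Measurable[m] (G.indicator fun a => pathSol p (fun t => x t a) (fun t => n t a) (y a) t) := by
  refine measurable_of_tendsto_metrizable (f := fun k : ℕ => G.indicator fun a =>
    euler p (fun t => x t a) (fun t => n t a) 0 (t / (k + 1)) (y a) (k + 1)) (fun k => ?_)
    (tendsto_pi_nhds.2 fun a => ?_)
  · have hk : (0 : ℝ≥0) + ((k + 1 : ℕ) : ℝ≥0) * (t / ((k : ℝ≥0) + 1)) = t := by
      rw [gridPoint_last, zero_add]
    exact (measurable_euler p 0 _ hy (k + 1) (by rwa [hk]) (by rwa [hk])).indicator hG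
  · by_cases ha : a ∈ G
    · simpa [ha] using tendsto_euler_pathSol hp (hGood a ha).1 (hGood a ha).2 (y a) t
    · simp [ha]

/-- Solutions along a path depend continuously on the initial value. -/
lemma abs_pathSol_sub_pathSol_le {p : ℝ} (hp : p ∈ Ioo (0 : ℝ) 1) {x : ℝ≥0 → ℝ} {n : ℝ≥0 → ℕ}
    (hx : IsCadlag x) (hn : IsCountingPath n) (y z : ℝ) (t : ℝ≥0) :
    |pathSol p x n y t - pathSol p x n z t| ≤ 2 ^ n t * |y - z| := by
  refine le_of_tendsto ((tendsto_euler_pathSol hp hx hn y t).sub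
    (tendsto_euler_pathSol hp hx hn z t)).abs (Eventually.of_forall fun m => ?_)
  have := abs_euler_sub_euler_le hp x hn.monotone 0 (t / ((m : ℝ≥0) + 1)) y z (m + 1)
  rwa [gridPoint_last, zero_add, hn.zero, Nat.sub_zero] at this

section

variable {Ω : Type*} [mΩ : MeasurableSpace Ω] {P : Measure Ω}
  {𝓕 : Filtration ℝ≥0 mΩ} {X : ℝ≥0 → Ω → ℝ} {rate : ℝ≥0} {N : ℝ≥0 → Ω → ℕ} {p : ℝ}

/-- The event that the driving paths are regular: `X` is càdlàg and `N` is a counting path. -/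
def goodPaths (X : ℝ≥0 → Ω → ℝ) (N : ℝ≥0 → Ω → ℕ) : Set Ω :=
  {ω | IsCadlag (fun t => X t ω) ∧ IsCountingPath (fun t => N t ω)}

lemma ae_mem_goodPaths (hX : IsLevyProcess 𝓕 P X) (hN : IsPoissonProcess 𝓕 P rate N) :
    ∀ᵐ ω ∂P, ω ∈ goodPaths X N := by
  filter_upwards [hX.cadlag, hN.zero, hN.monotone, hN.rightCts] with ω h1 h2 h3 h4
  exact ⟨h1, h3, h4, h2⟩

/-- The solution started from `y`, set to zero off the event `goodPaths X N`. -/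
noncomputable def flow (p : ℝ) (X : ℝ≥0 → Ω → ℝ) (N : ℝ≥0 → Ω → ℕ) (y : ℝ) (t : ℝ≥0) : Ω → ℝ :=
  (goodPaths X N).indicator fun ω => pathSol p (fun t => X t ω) (fun t => N t ω) y t

lemma measurableSet_goodPaths (h𝓕 : UsualConditions 𝓕 P) (hX : IsLevyProcess 𝓕 P X)
    (hN : IsPoissonProcess 𝓕 P rate N) : MeasurableSet (goodPaths X N) := by
  have := 𝓕.le 0 _ (h𝓕.complete _ (ae_mem_goodPaths hX hN))
  exact MeasurableSet.of_compl this

lemma measurable_flow (h𝓕 : UsualConditions 𝓕 P) (hX : IsLevyProcess 𝓕 P X)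
    (hN : IsPoissonProcess 𝓕 P rate N) (hp : p ∈ Ioo (0 : ℝ) 1) (t : ℝ≥0) :
    Measurable fun q : ℝ × Ω => flow p X N q.1 t q.2 := by
  have := measurable_indicator_pathSol (α := ℝ × Ω) hp (x := fun r q => X r q.2)
    (n := fun r q => N r q.2) (y := Prod.fst) (G := Prod.snd ⁻¹' goodPaths X N)
    (measurable_snd (measurableSet_goodPaths h𝓕 hX hN)) (fun q hq => hq) measurable_fst t
    (fun r _ => (hX.measurable r).comp measurable_snd)
    (fun r _ => (hN.measurable r).comp measurable_snd)
  exact this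

/-- The transition kernel: `y` is sent to the law at time `t` of the solution started from `y`. -/
noncomputable def transition (P : Measure Ω) (p : ℝ) (X : ℝ≥0 → Ω → ℝ) (N : ℝ≥0 → Ω → ℕ)
    (t : ℝ≥0) : Kernel ℝ ℝ :=
  (Kernel.id ×ₖ Kernel.const ℝ P).map fun q : ℝ × Ω => flow p X N q.1 t q.2

lemma transition_apply [IsProbabilityMeasure P] (h𝓕 : UsualConditions 𝓕 P)
    (hX : IsLevyProcess 𝓕 P X) (hN : IsPoissonProcess 𝓕 P rate N) (hp : p ∈ Ioo (0 : ℝ) 1)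
    (t : ℝ≥0) (y : ℝ) : transition P p X N t y = P.map (flow p X N y t) := by
  rw [transition, Kernel.map_apply _ (measurable_flow h𝓕 hX hN hp t), Kernel.prod_apply,
    Kernel.id_apply, Kernel.const_apply, Measure.dirac_prod,
    Measure.map_map (measurable_flow h𝓕 hX hN hp t) measurable_prodMk_left]
  rfl

lemma measurable_flow_apply (h𝓕 : UsualConditions 𝓕 P) (hX : IsLevyProcess 𝓕 P X)
    (hN : IsPoissonProcess 𝓕 P rate N) (hp : p ∈ Ioo (0 : ℝ) 1) (y : ℝ) (t : ℝ≥0) :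
    Measurable (flow p X N y t) :=
  (measurable_flow h𝓕 hX hN hp t).comp measurable_prodMk_left

lemma integral_transition [IsProbabilityMeasure P] (h𝓕 : UsualConditions 𝓕 P)
    (hX : IsLevyProcess 𝓕 P X) (hN : IsPoissonProcess 𝓕 P rate N) (hp : p ∈ Ioo (0 : ℝ) 1)
    (t : ℝ≥0) (y : ℝ) {g : ℝ → ℝ} (hg : Measurable g) :
    ∫ z, g z ∂(transition P p X N t y) = ∫ ω, g (flow p X N y t ω) ∂P := by
  rw [transition_apply h𝓕 hX hN hp, integral_map
    (measurable_flow_apply h𝓕 hX hN hp y t).aemeasurable hg.aestronglyMeasurable]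

/-- The transition kernels have the Feller property: they preserve bounded continuous functions. -/
lemma continuous_integral_transition [IsProbabilityMeasure P] (h𝓕 : UsualConditions 𝓕 P)
    (hX : IsLevyProcess 𝓕 P X) (hN : IsPoissonProcess 𝓕 P rate N) (hp : p ∈ Ioo (0 : ℝ) 1)
    (t : ℝ≥0) (g : BoundedContinuousFunction ℝ ℝ) :
    Continuous fun y => ∫ z, g z ∂(transition P p X N t y) := by
  simp_rw [integral_transition h𝓕 hX hN hp t _ g.continuous.measurable]
  refine continuous_of_dominated (bound := fun _ => ‖g‖) (fun y => ?_)
    (fun y => ae_of_all _ fun ω => g.norm_coe_le_norm _) (integrable_const _)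
    (ae_of_all _ fun ω => ?_)
  · exact (g.continuous.measurable.comp
      (measurable_flow_apply h𝓕 hX hN hp y t)).aestronglyMeasurable
  · refine g.continuous.comp ?_
    by_cases hω : ω ∈ goodPaths X N
    · simp only [flow, Set.indicator_of_mem hω]
      refine (LipschitzWith.of_dist_le_mul (K := 2 ^ N t ω) fun y z => ?_).continuous
      rw [Real.dist_eq, Real.dist_eq]
      simpa using abs_pathSol_sub_pathSol_le hp hω.1 hω.2 y z t
    · simp [flow, hω, continuous_const]

/-! ### The Markov property at deterministic times -/

/-- The one-step transition operator of the Euler scheme: `μ` is the law of the increment. -/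
noncomputable def eulerOp (p : ℝ) (μ : Measure (ℝ × ℝ)) (f : ℝ → ℝ) (y : ℝ) : ℝ :=
  ∫ z, f (eulerStep p y z) ∂μ

lemma measurable_eulerOp (p : ℝ) (μ : Measure (ℝ × ℝ)) [SFinite μ] {f : ℝ → ℝ}
    (hf : Measurable f) : Measurable (eulerOp p μ f) :=
  (StronglyMeasurable.integral_prod_right (f := fun y z => f (eulerStep p y z))
    (hf.comp (measurable_eulerStep p)).stronglyMeasurable).measurable

lemma abs_eulerOp_le (p : ℝ) (μ : Measure (ℝ × ℝ)) [IsProbabilityMeasure μ] {f : ℝ → ℝ} {C : ℝ}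
    (hf : ∀ y, |f y| ≤ C) (y : ℝ) : |eulerOp p μ f y| ≤ C := by
  have := norm_integral_le_of_norm_le_const (μ := μ) (f := fun z => f (eulerStep p y z))
    (ae_of_all _ fun z => hf _)
  simpa [eulerOp] using this

/-- On an event of the past, the joint law of a variable of the past and of an increment of the
driving pair is a product. -/
lemma map_prodMk_pairIncrement [IsProbabilityMeasure P] (hX : IsLevyProcess 𝓕 P X)
    (hN : IsPoissonProcess 𝓕 P rate N)
    (hXN : IndepFun (fun ω t => X t ω) (fun ω t => N t ω) P) {a h : ℝ≥0} {Y : Ω → ℝ}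
    (hY : Measurable[𝓕 a] Y) {A : Set Ω} (hA : MeasurableSet[𝓕 a] A) :
    (P.restrict A).map (fun ω => (Y ω, pairIncrement X N a h ω))
      = ((P.restrict A).map Y).prod (P.map (pairIncrement X N 0 h)) := by
  have hYm : Measurable Y := hY.mono (𝓕.le a) le_rfl
  have hDm : Measurable (pairIncrement X N a h) :=
    (measurable_pairIncrement hX hN a h).mono (𝓕.le _) le_rfl
  have hlaw : P.map (pairIncrement X N 0 h) = P.map (pairIncrement X N a h) := by
    rw [map_pairIncrement hX hN hXN, map_pairIncrement hX hN hXN]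
  rw [hlaw]
  symm
  refine Measure.prod_eq fun S T hS hT => ?_
  have hind := (Indep_iff _ _ P).1 (indep_pairIncrement hX hN hXN a h)
    (pairIncrement X N a h ⁻¹' T) (Y ⁻¹' S ∩ A) ⟨T, hT, rfl⟩ ((hY hS).inter hA)
  rw [Measure.map_apply (hYm.prodMk hDm) (hS.prod hT), Measure.map_apply hYm hS,
    Measure.map_apply hDm hT, Measure.restrict_apply ((hYm.prodMk hDm) (hS.prod hT)),
    Measure.restrict_apply (hYm hS), mul_comm, ← hind]
  congr 1
  ext ω
  simp only [mem_inter_iff, mem_preimage, mem_prod]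
  tauto

lemma setIntegral_eulerStep [IsProbabilityMeasure P] (hX : IsLevyProcess 𝓕 P X)
    (hN : IsPoissonProcess 𝓕 P rate N)
    (hXN : IndepFun (fun ω t => X t ω) (fun ω t => N t ω) P) {a h : ℝ≥0} {Y : Ω → ℝ}
    (hY : Measurable[𝓕 a] Y) {A : Set Ω} (hA : MeasurableSet[𝓕 a] A) {f : ℝ → ℝ} {C : ℝ}
    (hf : Measurable f) (hC : ∀ y, |f y| ≤ C) :
    ∫ ω in A, f (eulerStep p (Y ω) (pairIncrement X N a h ω)) ∂P
      = ∫ ω in A, eulerOp p (P.map (pairIncrement X N 0 h)) f (Y ω) ∂P := by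
  have hYm : Measurable Y := hY.mono (𝓕.le a) le_rfl
  have hDm : Measurable (pairIncrement X N a h) :=
    (measurable_pairIncrement hX hN a h).mono (𝓕.le _) le_rfl
  have hfs := hf.comp (measurable_eulerStep p)
  have e1 : ∫ ω in A, f (eulerStep p (Y ω) (pairIncrement X N a h ω)) ∂P
      = ∫ q, f (eulerStep p q.1 q.2)
        ∂((P.restrict A).map fun ω => (Y ω, pairIncrement X N a h ω)) :=
    (integral_map (hYm.prodMk hDm).aemeasurable hfs.aestronglyMeasurable).symm
  have e2 : ∫ ω in A, eulerOp p (P.map (pairIncrement X N 0 h)) f (Y ω) ∂P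
      = ∫ y, eulerOp p (P.map (pairIncrement X N 0 h)) f y ∂((P.restrict A).map Y) :=
    (integral_map hYm.aemeasurable (measurable_eulerOp p _ hf).aestronglyMeasurable).symm
  rw [e1, e2, map_prodMk_pairIncrement hX hN hXN hY hA, integral_prod]
  · rfl
  · exact Integrable.of_bound hfs.aestronglyMeasurable C (ae_of_all _ fun q => hC _)

/-- Conditional means of the Euler scheme given the past are iterates of its one-step operator. -/
lemma setIntegral_euler [IsProbabilityMeasure P] (hX : IsLevyProcess 𝓕 P X)
    (hN : IsPoissonProcess 𝓕 P rate N)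
    (hXN : IndepFun (fun ω t => X t ω) (fun ω t => N t ω) P) {s : ℝ≥0} (h : ℝ≥0) {Y : Ω → ℝ}
    (hY : Measurable[𝓕 s] Y) {A : Set Ω} (hA : MeasurableSet[𝓕 s] A) (k : ℕ) {f : ℝ → ℝ} {C : ℝ}
    (hf : Measurable f) (hC : ∀ y, |f y| ≤ C) :
    ∫ ω in A, f (euler p (fun t => X t ω) (fun t => N t ω) s h (Y ω) k) ∂P
      = ∫ ω in A, (eulerOp p (P.map (pairIncrement X N 0 h)))^[k] f (Y ω) ∂P := by
  induction k generalizing f with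
  | zero => rfl
  | succ k ih =>
    have hDm : Measurable (pairIncrement X N 0 h) :=
      (measurable_pairIncrement hX hN 0 h).mono (𝓕.le _) le_rfl
    have : IsProbabilityMeasure (P.map (pairIncrement X N 0 h)) :=
      Measure.isProbabilityMeasure_map hDm.aemeasurable
    rw [Function.iterate_succ_apply, ← ih (measurable_eulerOp p _ hf) (abs_eulerOp_le p _ hC)]
    refine setIntegral_eulerStep hX hN hXN (a := s + k * h) (measurable_euler p s h
      (hY.mono (𝓕.mono (by simp)) le_rfl) k (fun r hr => (hX.adapted r).mono (𝓕.mono hr) le_rfl)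
      (fun r hr => (hN.adapted r).mono (𝓕.mono hr) le_rfl)) (𝓕.mono (by simp) _ hA) hf hC

lemma measurable_eulerOp_iterate (p : ℝ) (μ : Measure (ℝ × ℝ)) [SFinite μ] (k : ℕ) {f : ℝ → ℝ}
    (hf : Measurable f) : Measurable ((eulerOp p μ)^[k] f) := by
  induction k generalizing f with
  | zero => exact hf
  | succ k ih => exact ih (measurable_eulerOp p μ hf)

/-- Iterates of the one-step operator are means of the Euler scheme started at time `0`. -/
lemma eulerOp_iterate_eq [IsProbabilityMeasure P] (hX : IsLevyProcess 𝓕 P X)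
    (hN : IsPoissonProcess 𝓕 P rate N)
    (hXN : IndepFun (fun ω t => X t ω) (fun ω t => N t ω) P) (h : ℝ≥0) (k : ℕ) {f : ℝ → ℝ} {C : ℝ}
    (hf : Measurable f) (hC : ∀ y, |f y| ≤ C) (y : ℝ) :
    (eulerOp p (P.map (pairIncrement X N 0 h)))^[k] f y
      = ∫ ω, f (euler p (fun t => X t ω) (fun t => N t ω) 0 h y k) ∂P := by
  have := setIntegral_euler (p := p) hX hN hXN h (s := 0) (Y := fun _ => y) measurable_const
    (A := univ) MeasurableSet.univ k hf hC
  simpa using this.symm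

/-- The Markov property at a deterministic time, tested against bounded continuous functions. -/
theorem setIntegral_comp_add [IsProbabilityMeasure P] (h𝓕 : UsualConditions 𝓕 P)
    (hX : IsLevyProcess 𝓕 P X) (hN : IsPoissonProcess 𝓕 P rate N)
    (hXN : IndepFun (fun ω t => X t ω) (fun ω t => N t ω) P) (hp : p ∈ Ioo (0 : ℝ) 1)
    {ξ : Ω → ℝ} {U : ℝ≥0 → Ω → ℝ} (hU : Adapted 𝓕 U)
    (hsol : ∀ᵐ ω ∂P, IsPathSolution p (fun t => X t ω) (fun t => N t ω) (ξ ω) fun t => U t ω)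
    (s t : ℝ≥0) {A : Set Ω} (hA : MeasurableSet[𝓕 s] A) (g : BoundedContinuousFunction ℝ ℝ) :
    ∫ ω in A, g (U (s + t) ω) ∂P
      = ∫ ω in A, ∫ z, g z ∂(transition P p X N t (U s ω)) ∂P := by
  have hgm : Measurable g := g.continuous.measurable
  have hgC : ∀ y, |g y| ≤ ‖g‖ := g.norm_coe_le_norm
  have hUm : Measurable (U s) := (hU s).mono (𝓕.le s) le_rfl
  have hem : ∀ (Y : Ω → ℝ), Measurable Y → ∀ (r h : ℝ≥0) (k : ℕ),
      Measurable fun ω => euler p (fun t => X t ω) (fun t => N t ω) r h (Y ω) k :=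
    fun Y hY r h k => measurable_euler p r h hY k (fun r _ => hX.measurable r)
      fun r _ => hN.measurable r
  set Ψ : ℕ → ℝ → ℝ := fun m y =>
    ∫ ω, g (euler p (fun t => X t ω) (fun t => N t ω) 0 (t / (m + 1)) y (m + 1)) ∂P with hΨ
  have hΨQ : ∀ m : ℕ, Ψ m
      = (eulerOp p (P.map (pairIncrement X N 0 (t / (m + 1)))))^[m + 1] g := fun m =>
    funext fun y => (eulerOp_iterate_eq hX hN hXN _ (m + 1) hgm hgC y).symm
  have hΨm : ∀ m, Measurable (Ψ m) := fun m => by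
    rw [hΨQ]
    exact measurable_eulerOp_iterate p _ _ hgm
  have hΨC : ∀ m y, |Ψ m y| ≤ ‖g‖ := fun m y => by
    have := norm_integral_le_of_norm_le_const (μ := P) (f := fun ω =>
      g (euler p (fun t => X t ω) (fun t => N t ω) 0 (t / (m + 1)) y (m + 1)))
      (ae_of_all _ fun ω => hgC _)
    simpa [hΨ] using this
  have hΨlim : ∀ y, Tendsto (fun m => Ψ m y) atTop (𝓝 (∫ z, g z ∂(transition P p X N t y))) := by
    intro y
    rw [integral_transition h𝓕 hX hN hp t y hgm]
    refine tendsto_integral_of_dominated_convergence (fun _ => ‖g‖)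
      (fun m => (hgm.comp (hem (fun _ => y) measurable_const _ _ _)).aestronglyMeasurable)
      (integrable_const _) (fun m => ae_of_all _ fun ω => hgC _) ?_
    filter_upwards [ae_mem_goodPaths hX hN] with ω hω
    simp only [flow, Set.indicator_of_mem hω]
    exact (g.continuous.tendsto _).comp (tendsto_euler_pathSol hp hω.1 hω.2 y t)
  have l1 : Tendsto (fun m : ℕ => ∫ ω in A,
      g (euler p (fun t => X t ω) (fun t => N t ω) s (t / (m + 1)) (U s ω) (m + 1)) ∂P) atTop
      (𝓝 (∫ ω in A, g (U (s + t) ω) ∂P)) := by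
    refine tendsto_integral_of_dominated_convergence (fun _ => ‖g‖)
      (fun m => (hgm.comp (hem _ hUm _ _ _)).aestronglyMeasurable)
      (integrable_const _) (fun m => ae_of_all _ fun ω => hgC _) (ae_restrict_of_ae ?_)
    filter_upwards [ae_mem_goodPaths hX hN, hsol] with ω hω hs
    exact (g.continuous.tendsto _).comp (hs.tendsto_euler hω.2 hp s t)
  have l2 : Tendsto (fun m : ℕ => ∫ ω in A, Ψ m (U s ω) ∂P) atTop
      (𝓝 (∫ ω in A, ∫ z, g z ∂(transition P p X N t (U s ω)) ∂P)) :=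
    tendsto_integral_of_dominated_convergence (fun _ => ‖g‖)
      (fun m => ((hΨm m).comp hUm).aestronglyMeasurable) (integrable_const _)
      (fun m => ae_of_all _ fun ω => hΨC m _) (ae_of_all _ fun ω => hΨlim (U s ω))
  refine tendsto_nhds_unique l1 (l2.congr fun m => ?_)
  rw [hΨQ, setIntegral_euler hX hN hXN _ (hU s) hA (m + 1) hgm hgC]

end

/-! ### Approximation of random times from the right -/

/-- The smallest point of the grid `ℕ / (m + 1)` which is strictly larger than `r`. -/
noncomputable def rightApprox (m : ℕ) (r : ℝ≥0) : ℝ≥0 := (⌊((m : ℝ≥0) + 1) * r⌋₊ + 1) / (m + 1)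

lemma le_rightApprox (m : ℕ) (r : ℝ≥0) : r ≤ rightApprox m r := by
  rw [rightApprox, le_div_iff₀ (by positivity), mul_comm]
  exact (Nat.lt_floor_add_one _).le

lemma rightApprox_le (m : ℕ) (r : ℝ≥0) : rightApprox m r ≤ r + 1 / ((m : ℝ≥0) + 1) := by
  have h : ((m : ℝ≥0) + 1) ≠ 0 := by positivity
  rw [rightApprox, div_le_iff₀ (by positivity), add_mul r, div_mul_cancel₀ _ h, mul_comm r]
  gcongr
  exact Nat.floor_le zero_le

lemma tendsto_rightApprox (r : ℝ≥0) :
    Tendsto (fun m => rightApprox m r) atTop (𝓝[≥] r) := by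
  refine tendsto_nhdsWithin_iff.2 ⟨?_, Eventually.of_forall fun m => le_rightApprox m r⟩
  refine tendsto_of_tendsto_of_tendsto_of_le_of_le tendsto_const_nhds ?_
    (fun m => le_rightApprox m r) (fun m => rightApprox_le m r)
  have : Tendsto (fun m : ℕ => r + 1 / ((m : ℝ≥0) + 1)) atTop (𝓝 (r + 0)) :=
    tendsto_one_div_add_atTop_nhds_zero_nat.const_add r
  simpa using this

lemma measurable_eval_rightApprox {Ω : Type*} {m : MeasurableSpace Ω} {V : ℝ≥0 → Ω → ℝ}
    (hV : ∀ r, Measurable[m] (V r)) {σ : Ω → ℝ≥0} (hσ : Measurable[m] σ) (k : ℕ) :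
    Measurable[m] fun ω => V (rightApprox k (σ ω)) ω := by
  obtain ⟨W, hW⟩ : ∃ W : ℕ → Ω → ℝ, W = fun (j : ℕ) => V ((j + 1) / (k + 1)) := ⟨_, rfl⟩
  have hWm : ∀ j, Measurable (W j) := fun j => hW ▸ hV _
  have h1 : Measurable fun q : ℕ × Ω => W q.1 q.2 :=
    measurable_from_prod_countable_right hWm
  have h2 : Measurable fun ω => ⌊((k : ℝ≥0) + 1) * σ ω⌋₊ :=
    Nat.measurable_floor.comp (hσ.const_mul _)
  have h3 : (fun ω => V (rightApprox k (σ ω)) ω)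
      = fun ω => W ⌊((k : ℝ≥0) + 1) * σ ω⌋₊ ω := by
    simp only [hW, rightApprox]
  rw [h3]
  exact h1.comp (h2.prodMk measurable_id)

/-- A process with a.e. right-continuous paths, evaluated at a random time, is measurable for every
σ-algebra that contains the null sets and makes the process and the random time measurable. -/
lemma measurable_eval {Ω : Type*} {m : MeasurableSpace Ω} [mΩ : MeasurableSpace Ω]
    {P : Measure Ω} (hnull : ∀ A : Set Ω, P A = 0 → MeasurableSet[m] A) {V : ℝ≥0 → Ω → ℝ}
    (hV : ∀ r, Measurable[m] (V r))
    (hc : ∀ᵐ ω ∂P, ∀ r, ContinuousWithinAt (fun t => V t ω) (Ici r) r)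
    {σ : Ω → ℝ≥0} (hσ : Measurable[m] σ) : Measurable[m] fun ω => V (σ ω) ω := by
  refine measurable_of_tendsto_ae_of_null (P := P) hnull
    (f := fun k ω => V (rightApprox k (σ ω)) ω)
    (fun k => measurable_eval_rightApprox hV hσ k) ?_
  filter_upwards [hc] with ω hω
  exact (hω (σ ω)).tendsto.comp (tendsto_rightApprox (σ ω))

/-- If all bounded continuous functions have the same mean under `V` and, after averaging by the
kernel `κ`, under `Y`, then the law of `V` is obtained from that of `Y` through `κ`. -/
lemma measure_preimage_eq_lintegral {Ω : Type*} [MeasurableSpace Ω] {μ : Measure Ω}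
    [IsFiniteMeasure μ] {V Y : Ω → ℝ} (hV : Measurable V) (hY : Measurable Y) (κ : Kernel ℝ ℝ)
    [IsMarkovKernel κ] (h : ∀ g : BoundedContinuousFunction ℝ ℝ,
      ∫ ω, g (V ω) ∂μ = ∫ ω, ∫ z, g z ∂(κ (Y ω)) ∂μ) {B : Set ℝ} (hB : MeasurableSet B) :
    μ (V ⁻¹' B) = ∫⁻ ω, κ (Y ω) B ∂μ := by
  have hfin : IsFiniteMeasure (μ.map Y) := inferInstance
  have hfin' : IsFiniteMeasure ((κ ∘ₖ Kernel.const Unit (μ.map Y)) ()) := inferInstance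
  have key : μ.map V = (κ ∘ₖ Kernel.const Unit (μ.map Y)) () := by
    refine ext_of_forall_integral_eq_of_IsFiniteMeasure fun g => ?_
    have hgi : Integrable g ((κ ∘ₖ Kernel.const Unit (μ.map Y)) ()) :=
      g.integrable _
    rw [integral_map hV.aemeasurable g.continuous.aestronglyMeasurable, h,
      Kernel.integral_comp hgi, Kernel.const_apply]
    have hm : StronglyMeasurable fun y => ∫ z, g z ∂(κ y) :=
      g.continuous.stronglyMeasurable.integral_kernel
    rw [integral_map hY.aemeasurable hm.aestronglyMeasurable]
  rw [← Measure.map_apply hV hB, key, Kernel.comp_apply' _ _ _ hB, Kernel.const_apply,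
    lintegral_map (Kernel.measurable_coe κ hB) hY]

section

variable {Ω : Type*} [mΩ : MeasurableSpace Ω] {P : Measure Ω}
  {𝓕 : Filtration ℝ≥0 mΩ} {X : ℝ≥0 → Ω → ℝ} {rate : ℝ≥0} {N : ℝ≥0 → Ω → ℕ} {p : ℝ}

/-! ### The strong Markov property -/

lemma isMarkovKernel_transition [IsProbabilityMeasure P] (h𝓕 : UsualConditions 𝓕 P)
    (hX : IsLevyProcess 𝓕 P X) (hN : IsPoissonProcess 𝓕 P rate N) (hp : p ∈ Ioo (0 : ℝ) 1)
    (t : ℝ≥0) : IsMarkovKernel (transition P p X N t) := by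
  refine ⟨fun y => ?_⟩
  rw [transition_apply h𝓕 hX hN hp]
  exact Measure.isProbabilityMeasure_map (measurable_flow_apply h𝓕 hX hN hp y t).aemeasurable

/-- The strong Markov property, tested against bounded continuous functions. The stopping time is
approximated from the right by discrete ones, for which the claim reduces to deterministic times;
the Feller property gives the limit of the right-hand sides. -/
theorem setIntegral_comp_stoppingTime_add [IsProbabilityMeasure P] (h𝓕 : UsualConditions 𝓕 P)
    (hX : IsLevyProcess 𝓕 P X) (hN : IsPoissonProcess 𝓕 P rate N)
    (hXN : IndepFun (fun ω t => X t ω) (fun ω t => N t ω) P) (hp : p ∈ Ioo (0 : ℝ) 1)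
    {ξ : Ω → ℝ} {U : ℝ≥0 → Ω → ℝ} (hU : Adapted 𝓕 U)
    (hsol : ∀ᵐ ω ∂P, IsPathSolution p (fun t => X t ω) (fun t => N t ω) (ξ ω) fun t => U t ω)
    {τ : Ω → WithTop ℝ≥0} (hτ : IsStoppingTime 𝓕 τ) (t : ℝ≥0) {A : Set Ω}
    (hA : MeasurableSet[hτ.measurableSpace] A) (hAτ : ∀ ω ∈ A, τ ω ≠ ⊤)
    (g : BoundedContinuousFunction ℝ ℝ) :
    ∫ ω in A, g (U ((τ ω).untopA + t) ω) ∂P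
      = ∫ ω in A, ∫ z, g z ∂(transition P p X N t (U (τ ω).untopA ω)) ∂P := by
  have hAm : MeasurableSet A := hτ.measurableSpace_le _ hA
  have hUm : ∀ r, Measurable (U r) := fun r => (hU r).mono (𝓕.le r) le_rfl
  have hτm : Measurable fun ω => (τ ω).untopA := hτ.measurable'.untopA
  have hgC : ∀ y, ‖g y‖ ≤ ‖g‖ := g.norm_coe_le_norm
  set Ψ : ℝ → ℝ := fun y => ∫ z, g z ∂(transition P p X N t y) with hΨ
  have hΨc : Continuous Ψ := continuous_integral_transition h𝓕 hX hN hp t g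
  have hΨC : ∀ y, ‖Ψ y‖ ≤ ‖g‖ := fun y => by
    have := isMarkovKernel_transition h𝓕 hX hN hp t
    have h := norm_integral_le_of_norm_le_const (μ := transition P p X N t y) (f := g)
      (ae_of_all _ fun z => hgC z)
    simpa [hΨ] using h
  have hm1 : ∀ m, Measurable fun ω => g (U (rightApprox m (τ ω).untopA + t) ω) := fun m =>
    g.continuous.measurable.comp
      (measurable_eval_rightApprox (V := fun r => U (r + t)) (fun r => hUm _) hτm m)
  have hm2 : ∀ m, Measurable fun ω => Ψ (U (rightApprox m (τ ω).untopA) ω) := fun m =>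
    hΨc.measurable.comp (measurable_eval_rightApprox hUm hτm m)
  have hdisc : ∀ m, ∫ ω in A, g (U (rightApprox m (τ ω).untopA + t) ω) ∂P
      = ∫ ω in A, Ψ (U (rightApprox m (τ ω).untopA) ω) ∂P := by
    intro m
    set K : Ω → ℕ := fun ω => ⌊((m : ℝ≥0) + 1) * (τ ω).untopA⌋₊ with hK
    set q : ℕ → ℝ≥0 := fun k => (k + 1) / (m + 1) with hq
    set E : ℕ → Set Ω := fun k => A ∩ {ω | K ω = k} with hE
    have hEA : A = ⋃ k, E k := by
      ext ω; simp [hE]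
    have hEF : ∀ k, MeasurableSet[𝓕 (q k)] (E k) := by
      intro k
      have e : E k = (A ∩ {ω | τ ω ≤ q k}) ∩ ({ω | τ ω < q k}
          ∩ {ω | ((k / (m + 1) : ℝ≥0) : WithTop ℝ≥0) ≤ τ ω}) := by
        ext ω
        simp only [hE, hK, mem_inter_iff, mem_ofPred_eq]
        by_cases hω : ω ∈ A
        · obtain ⟨r, hr⟩ := WithTop.ne_top_iff_exists.1 (hAτ ω hω)
          have hpos : (0 : ℝ≥0) < (m : ℝ≥0) + 1 := by positivity
          rw [← hr]
          simp only [hω, true_and, WithTop.untopD_coe, WithTop.coe_le_coe, WithTop.coe_lt_coe]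
          rw [Nat.floor_eq_iff zero_le, hq, lt_div_iff₀ hpos, div_le_iff₀ hpos, mul_comm r,
            le_div_iff₀ hpos, mul_comm r]
          exact ⟨fun h => ⟨h.2.le, h.2, h.1⟩, fun h => ⟨h.2.2, h.2.1⟩⟩
        · simp [hω]
      rw [e]
      refine (hA.2 (q k)).inter
        ((hτ.measurableSet_lt _).inter (𝓕.mono ?_ _ (hτ.measurableSet_ge _)))
      exact div_le_div_of_nonneg_right (by simp) (by positivity)
    have hEm : ∀ k, MeasurableSet (E k) := fun k => 𝓕.le _ _ (hEF k)
    have hdisj : Pairwise (Function.onFun Disjoint E) := by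
      intro i j hij
      rw [Function.onFun, Set.disjoint_left]
      intro ω h1 h2
      exact hij (h1.2.symm.trans h2.2)
    rw [hEA, integral_iUnion hEm hdisj
        (Integrable.of_bound (hm1 m).aestronglyMeasurable _ (ae_of_all _ fun ω => hgC _)),
      integral_iUnion hEm hdisj
        (Integrable.of_bound (hm2 m).aestronglyMeasurable _ (ae_of_all _ fun ω => hΨC _))]
    refine tsum_congr fun k => ?_
    have hk : ∀ ω ∈ E k, rightApprox m (τ ω).untopA = q k := by
      rintro ω ⟨-, hω⟩
      have hω' : ⌊((m : ℝ≥0) + 1) * (τ ω).untopA⌋₊ = k := hω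
      rw [rightApprox, hω']
    calc ∫ ω in E k, g (U (rightApprox m (τ ω).untopA + t) ω) ∂P
        = ∫ ω in E k, g (U (q k + t) ω) ∂P :=
          setIntegral_congr_fun (hEm k) fun ω hω => by simp only [hk ω hω]
      _ = ∫ ω in E k, Ψ (U (q k) ω) ∂P :=
          setIntegral_comp_add h𝓕 hX hN hXN hp hU hsol (q k) t (hEF k) g
      _ = ∫ ω in E k, Ψ (U (rightApprox m (τ ω).untopA) ω) ∂P :=
          setIntegral_congr_fun (hEm k) fun ω hω => by simp only [hk ω hω]
  have l1 : Tendsto (fun m : ℕ => ∫ ω in A, g (U (rightApprox m (τ ω).untopA + t) ω) ∂P) atTop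
      (𝓝 (∫ ω in A, g (U ((τ ω).untopA + t) ω) ∂P)) := by
    refine tendsto_integral_of_dominated_convergence (fun _ => ‖g‖)
      (fun m => (hm1 m).aestronglyMeasurable) (integrable_const _)
      (fun m => ae_of_all _ fun ω => hgC _) (ae_restrict_of_ae ?_)
    filter_upwards [hsol] with ω hω
    refine (g.continuous.tendsto _).comp ((hω.cadlag.1 _).tendsto.comp ?_)
    refine tendsto_nhdsWithin_iff.2 ⟨?_, Eventually.of_forall fun m => ?_⟩
    · exact (tendsto_nhdsWithin_iff.1 (tendsto_rightApprox _)).1.add_const t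
    · exact add_le_add_left (le_rightApprox m _) t
  have l2 : Tendsto (fun m : ℕ => ∫ ω in A, Ψ (U (rightApprox m (τ ω).untopA) ω) ∂P) atTop
      (𝓝 (∫ ω in A, Ψ (U (τ ω).untopA ω) ∂P)) := by
    refine tendsto_integral_of_dominated_convergence (fun _ => ‖g‖)
      (fun m => (hm2 m).aestronglyMeasurable) (integrable_const _)
      (fun m => ae_of_all _ fun ω => hΨC _) (ae_restrict_of_ae ?_)
    filter_upwards [hsol] with ω hω
    exact (hΨc.tendsto _).comp ((hω.cadlag.1 _).tendsto.comp (tendsto_rightApprox _))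
  exact tendsto_nhds_unique l1 (l2.congr fun m => (hdisc m).symm)

/-- The value of a right-continuous adapted process at a stopping time `τ`, set to zero where
`τ = ∞`, is measurable with respect to the σ-algebra of `τ`. -/
lemma measurable_indicator_eval (h𝓕 : UsualConditions 𝓕 P) {U : ℝ≥0 → Ω → ℝ} (hU : Adapted 𝓕 U)
    (hc : ∀ᵐ ω ∂P, IsCadlag fun t => U t ω) {τ : Ω → WithTop ℝ≥0} (hτ : IsStoppingTime 𝓕 τ) :
    Measurable[hτ.measurableSpace] ({ω | τ ω ≠ ⊤}.indicator fun ω => U (τ ω).untopA ω) := by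
  have hnull : ∀ (i : ℝ≥0) (A : Set Ω), P A = 0 → MeasurableSet[𝓕 i] A := fun i A hA =>
    𝓕.mono (zero_le) _ (h𝓕.complete A hA)
  intro B hB
  refine ⟨?_, fun i => ?_⟩
  · have h1 : Measurable[⨆ t, 𝓕 t] fun ω => U (τ ω).untopA ω :=
      measurable_eval (P := P) (fun A hA => le_iSup (fun t => 𝓕 t) 0 _ (h𝓕.complete A hA))
        (fun r => (hU r).mono (le_iSup (fun t => 𝓕 t) r) le_rfl)
        (hc.mono fun ω hω => hω.1) hτ.measurable_iSup.untopA
    exact (h1.indicator hτ.measurableSet_eq_top'.compl) hB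
  · have hσ : Measurable[𝓕 i] fun ω => (min (τ ω) i).untopA :=
      ((hτ.min_const i).measurable_of_le fun ω => min_le_right _ _).untopA
    have h1 : Measurable[𝓕 i] fun ω => U (min (min (τ ω) i).untopA i) ω := by
      refine measurable_eval (P := P) (hnull i) (V := fun r => U (min r i))
        (fun r => (hU _).mono (𝓕.mono (min_le_right _ _)) le_rfl) ?_ hσ
      filter_upwards [hc] with ω hω r
      refine ContinuousWithinAt.comp (t := Ici (min r i)) (f := fun t => min t i) (hω.1 (min r i))
        (by fun_prop) fun s hs => ?_
      exact min_le_min_right i hs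
    have e : ({ω | τ ω ≠ ⊤}.indicator fun ω => U (τ ω).untopA ω) ⁻¹' B ∩ {ω | τ ω ≤ i}
        = (fun ω => U (min (min (τ ω) i).untopA i) ω) ⁻¹' B ∩ {ω | τ ω ≤ i} := by
      ext ω
      simp only [mem_inter_iff, mem_preimage, mem_ofPred_eq, and_congr_left_iff]
      intro hω
      have hne : τ ω ≠ ⊤ := ne_top_of_le_ne_top WithTop.coe_ne_top hω
      obtain ⟨r, hr⟩ := WithTop.ne_top_iff_exists.1 hne
      rw [Set.indicator_of_mem (show ω ∈ {ω | τ ω ≠ ⊤} from hne), min_eq_left hω]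
      rw [← hr] at hω ⊢
      rw [show (r : WithTop ℝ≥0).untopA = r from rfl, min_eq_left (WithTop.coe_le_coe.1 hω)]
    rw [e]
    exact (h1 hB).inter (hτ i)

/-- The strong Markov property of an adapted process that solves the equation path by path. -/
theorem condExp_indicator_eq_transition [IsProbabilityMeasure P] (h𝓕 : UsualConditions 𝓕 P)
    (hX : IsLevyProcess 𝓕 P X) (hN : IsPoissonProcess 𝓕 P rate N)
    (hXN : IndepFun (fun ω t => X t ω) (fun ω t => N t ω) P) (hp : p ∈ Ioo (0 : ℝ) 1)
    {ξ : Ω → ℝ} {U : ℝ≥0 → Ω → ℝ} (hU : Adapted 𝓕 U)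
    (hsol : ∀ᵐ ω ∂P, IsPathSolution p (fun t => X t ω) (fun t => N t ω) (ξ ω) fun t => U t ω)
    {τ : Ω → WithTop ℝ≥0} (hτ : IsStoppingTime 𝓕 τ) (t : ℝ≥0) {B : Set ℝ} (hB : MeasurableSet B) :
    P[{ω | τ ω ≠ ⊤ ∧ U ((τ ω).untopA + t) ω ∈ B}.indicator (fun _ => (1 : ℝ)) |
        hτ.measurableSpace]
      =ᵐ[P] {ω | τ ω ≠ ⊤}.indicator
        (fun ω => (transition P p X N t (U (τ ω).untopA ω)).real B) := by
  have hmarkov := isMarkovKernel_transition h𝓕 hX hN hp t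
  have hnull : ∀ A : Set Ω, P A = 0 → MeasurableSet A := fun A hA => 𝓕.le 0 _ (h𝓕.complete A hA)
  have hUm : ∀ r, Measurable (U r) := fun r => (hU r).mono (𝓕.le r) le_rfl
  have hτm : Measurable fun ω => (τ ω).untopA := hτ.measurable'.untopA
  have hc : ∀ᵐ ω ∂P, IsCadlag fun t => U t ω := hsol.mono fun ω hω => hω.cadlag
  have hY : Measurable fun ω => U (τ ω).untopA ω :=
    measurable_eval (P := P) hnull hUm (hc.mono fun ω hω => hω.1) hτm
  have hV : Measurable fun ω => U ((τ ω).untopA + t) ω := by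
    refine measurable_eval (P := P) hnull (V := fun r => U (r + t)) (fun r => hUm _) ?_ hτm
    filter_upwards [hc] with ω hω r
    refine ContinuousWithinAt.comp (t := Ici (r + t)) (f := fun s => s + t) (hω.1 (r + t))
      (by fun_prop) fun s hs => ?_
    exact add_le_add_left hs t
  have hκm : Measurable fun y => (transition P p X N t y).real B :=
    (Kernel.measurable_coe _ hB).ennreal_toReal
  have hfin : MeasurableSet[hτ.measurableSpace] {ω | τ ω ≠ ⊤} :=
    (@measurableSet_singleton _ _ _ (⊤ : WithTop ℝ≥0)).compl |> hτ.measurable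
  have hfin' : MeasurableSet {ω | τ ω ≠ ⊤} := hτ.measurableSpace_le _ hfin
  have hsplit : {ω | τ ω ≠ ⊤ ∧ U ((τ ω).untopA + t) ω ∈ B}.indicator (fun _ => (1 : ℝ))
      = {ω | τ ω ≠ ⊤}.indicator
        (((fun ω => U ((τ ω).untopA + t) ω) ⁻¹' B).indicator fun _ => (1 : ℝ)) := by
    rw [Set.indicator_indicator]
    rfl
  have hκi : Integrable (fun ω => (transition P p X N t (U (τ ω).untopA ω)).real B) P :=
    Integrable.of_bound (hκm.comp hY).aestronglyMeasurable 1 (ae_of_all _ fun ω => by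
      rw [Real.norm_of_nonneg measureReal_nonneg]; exact measureReal_le_one)
  symm
  rw [hsplit]
  refine ae_eq_condExp_of_forall_setIntegral_eq hτ.measurableSpace_le
    (((integrable_const _).indicator (hV hB)).indicator hfin')
    (fun s _ _ => (hκi.indicator hfin').integrableOn) (fun s hs _ => ?_) ?_
  · have hsm := hτ.measurableSpace_le _ hs
    rw [setIntegral_indicator hfin', setIntegral_indicator hfin',
      setIntegral_indicator (hV hB)]
    have hA : MeasurableSet[hτ.measurableSpace] (s ∩ {ω | τ ω ≠ ⊤}) := hs.inter hfin
    have key := measure_preimage_eq_lintegral (μ := P.restrict (s ∩ {ω | τ ω ≠ ⊤})) hV hY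
      (transition P p X N t)
      (fun g => setIntegral_comp_stoppingTime_add h𝓕 hX hN hXN hp hU hsol hτ t hA
        (fun ω hω => hω.2) g) hB
    have e1 : ∫ ω in s ∩ {ω | τ ω ≠ ⊤}, (transition P p X N t (U (τ ω).untopA ω)).real B ∂P
        = (∫⁻ ω in s ∩ {ω | τ ω ≠ ⊤}, transition P p X N t (U (τ ω).untopA ω) B ∂P).toReal :=
      integral_toReal ((Kernel.measurable_coe _ hB).comp hY).aemeasurable
        (ae_of_all _ fun ω => measure_lt_top _ _)
    rw [e1, ← key, Measure.restrict_apply (hV hB), setIntegral_const, inter_comm]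
    simp [measureReal_def]
  · have hW := measurable_indicator_eval h𝓕 hU hc hτ
    have e : {ω | τ ω ≠ ⊤}.indicator (fun ω => (transition P p X N t (U (τ ω).untopA ω)).real B)
        = {ω | τ ω ≠ ⊤}.indicator (fun ω => (transition P p X N t
          (({ω | τ ω ≠ ⊤}.indicator fun ω => U (τ ω).untopA ω) ω)).real B) := by
      refine Set.indicator_congr fun ω hω => ?_
      rw [Set.indicator_of_mem hω]
    rw [e]
    have hm : Measurable[hτ.measurableSpace] ({ω | τ ω ≠ ⊤}.indicator (fun ω =>
      (transition P p X N t (({ω | τ ω ≠ ⊤}.indicator fun ω => U (τ ω).untopA ω) ω)).real B)) :=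
      (hκm.comp hW).indicator hfin
    exact hm.stronglyMeasurable.aestronglyMeasurable

/-! ### Existence, uniqueness and the transition semigroup -/

lemma flow_of_mem {Ω : Type*} {X : ℝ≥0 → Ω → ℝ} {N : ℝ≥0 → Ω → ℕ}
    {ω : Ω} (hω : ω ∈ goodPaths X N) (y : ℝ) (t : ℝ≥0) :
    flow p X N y t ω = pathSol p (fun t => X t ω) (fun t => N t ω) y t := by
  simp [flow, hω]

lemma isPathSolution_flow_ae (hX : IsLevyProcess 𝓕 P X) (hN : IsPoissonProcess 𝓕 P rate N)
    (p : ℝ) (ξ : Ω → ℝ) : ∀ᵐ ω ∂P, IsPathSolution p (fun t => X t ω) (fun t => N t ω) (ξ ω)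
      fun t => flow p X N (ξ ω) t ω := by
  filter_upwards [ae_mem_goodPaths hX hN] with ω hω
  simp only [flow_of_mem hω]
  exact isPathSolution_pathSol p hω.1 hω.2 (ξ ω)

/-- The flow started from a random initial value is measurable in the data up to time `t`. -/
lemma measurable_flow_comp {Ω : Type*} {m : MeasurableSpace Ω} {X : ℝ≥0 → Ω → ℝ}
    {N : ℝ≥0 → Ω → ℕ} (hp : p ∈ Ioo (0 : ℝ) 1)
    (hG : MeasurableSet[m] (goodPaths X N)) {ξ : Ω → ℝ} (hξ : Measurable[m] ξ) (t : ℝ≥0)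
    (hX : ∀ r ≤ t, Measurable[m] (X r)) (hN : ∀ r ≤ t, Measurable[m] (N r)) :
    Measurable[m] fun ω => flow p X N (ξ ω) t ω := by
  convert measurable_indicator_pathSol hp hG (fun ω hω => hω) hξ t hX hN using 1
  ext ω
  by_cases hω : ω ∈ goodPaths X N <;> simp [flow, hω]

lemma dataSigma_le (h𝓕 : UsualConditions 𝓕 P) (hX : IsLevyProcess 𝓕 P X)
    (hN : IsPoissonProcess 𝓕 P rate N) {ξ : Ω → ℝ} (hξ : Measurable[𝓕 0] ξ) (t : ℝ≥0) :
    dataSigma P X N ξ t ≤ 𝓕 t := by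
  refine sup_le (sup_le ?_ (iSup_le fun s => sup_le ?_ ?_)) ?_
  · exact hξ.comap_le.trans (𝓕.mono zero_le)
  · exact (hX.adapted s).comap_le.trans (𝓕.mono s.2)
  · exact (hN.adapted s).comap_le.trans (𝓕.mono s.2)
  · exact MeasurableSpace.generateFrom_le fun A hA => 𝓕.mono zero_le _ (h𝓕.complete A hA)

lemma measurable_dataSigma_flow (hX : IsLevyProcess 𝓕 P X) (hN : IsPoissonProcess 𝓕 P rate N)
    (hp : p ∈ Ioo (0 : ℝ) 1) (ξ : Ω → ℝ) (t : ℝ≥0) :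
    Measurable[dataSigma P X N ξ t] fun ω => flow p X N (ξ ω) t ω := by
  have hpath : ∀ r ≤ t, MeasurableSpace.comap (X r) inferInstance
      ⊔ MeasurableSpace.comap (N r) inferInstance ≤ dataSigma P X N ξ t := fun r hr =>
    (le_iSup (fun s : Set.Iic t => MeasurableSpace.comap (X s) inferInstance
      ⊔ MeasurableSpace.comap (N s) inferInstance) ⟨r, hr⟩).trans (le_sup_right.trans le_sup_left)
  refine measurable_flow_comp hp ?_ ?_ t (fun r hr => ?_) (fun r hr => ?_)
  · have h0 : P (goodPaths X N)ᶜ = 0 := ae_mem_goodPaths hX hN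
    have : MeasurableSet[MeasurableSpace.generateFrom {A : Set Ω | P A = 0}] (goodPaths X N)ᶜ :=
      MeasurableSpace.measurableSet_generateFrom h0
    exact MeasurableSet.of_compl
      ((le_sup_right : _ ≤ dataSigma P X N ξ t) _ this)
  · exact Measurable.of_comap_le (le_sup_left.trans le_sup_left)
  · exact Measurable.of_comap_le (le_sup_left.trans (hpath r hr))
  · exact Measurable.of_comap_le (le_sup_right.trans (hpath r hr))

lemma isStrongSolution_flow (h𝓕 : UsualConditions 𝓕 P) (hX : IsLevyProcess 𝓕 P X)
    (hN : IsPoissonProcess 𝓕 P rate N) (hp : p ∈ Ioo (0 : ℝ) 1) {ξ : Ω → ℝ}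
    (hξ : Measurable[𝓕 0] ξ) :
    IsStrongSolution 𝓕 P p X N ξ fun t ω => flow p X N (ξ ω) t ω where
  adapted t := (measurable_dataSigma_flow hX hN hp ξ t).mono (dataSigma_le h𝓕 hX hN hξ t) le_rfl
  cadlag := (isPathSolution_flow_ae hX hN p ξ).mono fun ω hω => hω.cadlag
  sde := by
    filter_upwards [isPathSolution_flow_ae hX hN p ξ, ae_mem_goodPaths hX hN] with ω hω hgood
    let S : StieltjesFunction ℝ≥0 :=
      { toFun := fun s => (N s ω : ℝ)
        mono' := fun a b hab => Nat.cast_le.2 (hgood.2.monotone hab)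
        right_continuous' := fun s =>
          (continuous_of_discreteTopology (f := (Nat.cast : ℕ → ℝ))).continuousAt
            |>.comp_continuousWithinAt (hgood.2.rightCts s) }
    refine ⟨S, fun s => rfl, fun t => ?_⟩
    rw [hgood.2.integral_stieltjes (S := S) (fun s => rfl)]
    exact hω.eq t
  strong := measurable_dataSigma_flow hX hN hp ξ

lemma IsSolution.isPathSolution_ae (hX : IsLevyProcess 𝓕 P X) (hN : IsPoissonProcess 𝓕 P rate N)
    {ξ : Ω → ℝ} {U : ℝ≥0 → Ω → ℝ} (hU : IsSolution 𝓕 P p X N ξ U) :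
    ∀ᵐ ω ∂P, IsPathSolution p (fun t => X t ω) (fun t => N t ω) (ξ ω) fun t => U t ω := by
  filter_upwards [hU.cadlag, hU.sde, ae_mem_goodPaths hX hN] with ω h1 h2 hgood
  obtain ⟨S, hS, hSU⟩ := h2
  refine ⟨h1, fun t => ?_⟩
  rw [hSU t, hgood.2.integral_stieltjes hS]

lemma IsPathSolution.apply_zero {x : ℝ≥0 → ℝ} {n : ℝ≥0 → ℕ} {y : ℝ} {u : ℝ≥0 → ℝ}
    (hu : IsPathSolution p x n y u) (hn : IsCountingPath n) : u 0 = y := by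
  simp [hu.eq 0, hn.zero]

/-- Solutions along a path are unique: they are limits of the same Euler schemes. -/
lemma IsPathSolution.unique {x : ℝ≥0 → ℝ} {n : ℝ≥0 → ℕ} {y : ℝ} {u v : ℝ≥0 → ℝ}
    (hu : IsPathSolution p x n y u) (hv : IsPathSolution p x n y v) (hn : IsCountingPath n)
    (hp : p ∈ Ioo (0 : ℝ) 1) (t : ℝ≥0) : u t = v t := by
  have h1 := hu.tendsto_euler hn hp 0 t
  have h2 := hv.tendsto_euler hn hp 0 t
  rw [hu.apply_zero hn, zero_add] at h1
  rw [hv.apply_zero hn, zero_add] at h2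
  exact tendsto_nhds_unique h1 h2

/-- The semigroup property is the Markov property of the solution started from a constant. -/
lemma isTransitionSemigroup_transition [IsProbabilityMeasure P] (h𝓕 : UsualConditions 𝓕 P)
    (hX : IsLevyProcess 𝓕 P X) (hN : IsPoissonProcess 𝓕 P rate N)
    (hXN : IndepFun (fun ω t => X t ω) (fun ω t => N t ω) P) (hp : p ∈ Ioo (0 : ℝ) 1) :
    IsTransitionSemigroup (transition P p X N) where
  markov := isMarkovKernel_transition h𝓕 hX hN hp
  zero := by
    ext1 y
    rw [transition_apply h𝓕 hX hN hp, Kernel.id_apply]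
    have : flow p X N y 0 =ᵐ[P] fun _ => y := by
      filter_upwards [ae_mem_goodPaths hX hN] with ω hω
      rw [flow_of_mem hω, pathSol_zero p _ hω.2]
    rw [Measure.map_congr this, Measure.map_const]
    simp
  add s t := by
    ext y B hB
    have hmarkov := isMarkovKernel_transition h𝓕 hX hN hp t
    have hm := measurable_flow_apply h𝓕 hX hN hp y
    rw [Kernel.comp_apply' _ _ _ hB, transition_apply h𝓕 hX hN hp s,
      transition_apply h𝓕 hX hN hp (s + t), Measure.map_apply (hm _) hB,
      lintegral_map (Kernel.measurable_coe _ hB) (hm s)]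
    refine measure_preimage_eq_lintegral (hm _) (hm s) _ (fun g => ?_) hB
    have h := setIntegral_comp_add h𝓕 hX hN hXN hp (ξ := fun _ => y) (U := flow p X N y)
      (isStrongSolution_flow h𝓕 hX hN hp (ξ := fun _ => y) measurable_const).adapted
      (isPathSolution_flow_ae hX hN p fun _ => y) s t MeasurableSet.univ g
    simpa using h

end

end PartialResetting

/-- Existence, uniqueness and the strong Markov property for
`dU_t = dX_t - (1 - p) U_{t-} dN_t`. The transition semigroup `κ` is the same for all initial
values. -/
theorem theorem3p0 {Ω : Type*} [mΩ : MeasurableSpace Ω] (P : Measure Ω) [IsProbabilityMeasure P]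
    (𝓕 : Filtration ℝ≥0 mΩ) (h𝓕 : PartialResetting.UsualConditions 𝓕 P)
    (X : ℝ≥0 → Ω → ℝ) (hX : PartialResetting.IsSpectrallyNegativeLevy 𝓕 P X)
    (rate : ℝ≥0) (hrate : 0 < rate)
    (N : ℝ≥0 → Ω → ℕ) (hN : PartialResetting.IsPoissonProcess 𝓕 P rate N)
    (hXN : IndepFun (fun ω t => X t ω) (fun ω t => N t ω) P)
    (p : ℝ) (hp : p ∈ Set.Ioo (0 : ℝ) 1) :
    ∃ κ : ℝ≥0 → Kernel ℝ ℝ, ∀ ξ : Ω → ℝ, Measurable[𝓕 0] ξ →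
      (∃ U : ℝ≥0 → Ω → ℝ, PartialResetting.IsStrongSolution 𝓕 P p X N ξ U) ∧
      (∀ U V : ℝ≥0 → Ω → ℝ, PartialResetting.IsSolution 𝓕 P p X N ξ U →
        PartialResetting.IsSolution 𝓕 P p X N ξ V → ∀ᵐ ω ∂P, ∀ t, U t ω = V t ω) ∧
      (∀ U : ℝ≥0 → Ω → ℝ, PartialResetting.IsSolution 𝓕 P p X N ξ U →
        PartialResetting.IsStrongMarkov 𝓕 P κ U) := by
  have hL := hX.toIsLevyProcess
  refine ⟨PartialResetting.transition P p X N, fun ξ hξ => ⟨⟨_,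
    PartialResetting.isStrongSolution_flow h𝓕 hL hN hp hξ⟩, fun U V hU hV => ?_, fun U hU =>
    ⟨PartialResetting.isTransitionSemigroup_transition h𝓕 hL hN hXN hp, hU.adapted,
      fun τ hτ t B hB => PartialResetting.condExp_indicator_eq_transition h𝓕 hL hN hXN hp
        hU.adapted (hU.isPathSolution_ae hL hN) hτ t hB⟩⟩⟩
  filter_upwards [hU.isPathSolution_ae hL hN, hV.isPathSolution_ae hL hN,
    PartialResetting.ae_mem_goodPaths hL hN] with ω h1 h2 hω t
  exact h1.unique h2 hω.2 hp t
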